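/- **Model.** Time is divided into synchronous rounds $r=1,2,\dots$. A dynamic network on a set $V$ of $n$ nodes is a sequence of undirected graphs $G_1,G_2,\dots$ on $V$, where $G_r=(V,E_r)$ is the topology in round $r$. It is *$T$-interval $k$-connected* if for every $r\ge 1$ the graph $\big(V,\bigcap_{r'=r}^{r+T-1}E_{r'}\big)$ has vertex connectivity at least $k$ (it has more than $k$ vertices and stays connected after the deletion of any fewer than $k$ vertices). In each round every node either transmits a message or listens; a listening node $v$ receives a message in round $r$ if and only if exactly one neighbor of $v$ in $G_r$ transmits in round $r$, and otherwise (no transmitting neighbor, or at least two) it receives the silence symbol $\bot$. A randomized distributed algorithm consists of $n$ processes, one for each node, which make independent random choices in every round. In single-message broadcast, one source node initially knows a message $\mathcal M$, which all nodes have to receive; the other nodes are activated when they first receive $\mathcal M$ and remain silent before. The topologies are chosen by an adversary that knows the algorithm. It is *$\tau$-oblivious* if for every $r\ge1$ it determines $G_r$ from the algorithm, the topologies of rounds $1,\dots,r-1$, and the random choices that the nodes made in the first $r-\tau$ rounds. **Theorem.** For every $c>0$ there is a constant $C>0$ such that for all positive integers $n,T,\tau,k$ there is a randomized distributed algorithm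 for $n$ nodes (which may depend on $n,T,\tau,k,c$) with the following property. For every source node and every $\tau$-oblivious adversary whose dynamic network is always $T$-interval $k$-connected, with probability at least $1-n^{-c}$ all nodes have received $\mathcal M$ after at most $$C\cdot\left(1+\frac{n}{k\cdot\min\{\tau,T\}}\right)\cdot n\,\log^3 n$$ rounds. -/

import Mathlib

open MeasureTheory

/-- `G` has vertex connectivity at least `k`: it has more than `k` vertices, and it stays connected
after the removal of any set of fewer than `k` vertices. -/
def KVertexConnected {V : Type*} [Fintype V] (k : ℕ) (G : SimpleGraph V) : Prop :=
  k < Fintype.card V ∧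
    ∀ S : Finset V, S.card < k → (G.induce {v : V | v ∉ S}).Connected

/-- The dynamic graph `G 0, G 1, …` (`G r` is the topology of the `(r+1)`-st round) is `T`-interval
`k`-connected: for every `T` consecutive rounds, the graph formed by the edges that are present in
all of these rounds has vertex connectivity at least `k`. -/
def IntervalConnected {V : Type*} [Fintype V] (T k : ℕ) (G : ℕ → SimpleGraph V) : Prop :=
  ∀ r : ℕ, KVertexConnected k (⨅ i : Fin T, G (r + i))

open Classical in
/-- The radio channel. In a round with topology `G`, `sent u` is the packet transmitted by node `u`,
or `none` if `u` listens. A listening node receives a packet if and only if exactly one of its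
neighbors transmits; otherwise (silence or collision), and if it transmits itself, it gets
`none`. -/
noncomputable def received {V M : Type*} (G : SimpleGraph V) (sent : V → Option M) (v : V) :
    Option M :=
  if h : sent v = none ∧ ∃! u : V, G.Adj v u ∧ sent u ≠ none then sent h.2.choose else none

/-- A randomized distributed algorithm for single-message broadcast, run by `n` processes in
synchronous rounds. In every round each process draws a fresh random element of the discrete set
`Coin`, independently of everything else. A packet consists of the broadcast message, which every
transmitting node knows and which is left implicit, together with additional content in `Msg`. -/
structure BroadcastAlgorithm (n : ℕ) where
  /-- possible outcomes of the random choice of a process in a round -/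
  Coin : Type
  [countable_coin : Countable Coin]
  /-- distribution of the random choice -/
  coinLaw : PMF Coin
  /-- local states of the processes that know the broadcast message -/
  State : Type
  /-- additional content of the packets -/
  Msg : Type
  /-- initial state of the process `v` if it is the source -/
  init : Fin n → State
  /-- state of the process `v`, if it is not the source, on being activated by its first packet -/
  wake : Fin n → Msg → State
  /-- what an activated process does in a round, depending on its state and on its random choice of
  this round: transmit a packet, or listen (`none`) -/
  send : Fin n → State → Coin → Option Msg
  /-- new state of an activated process after a round, depending on its state, on its random choice
  of this round and on what it received in this round -/
  next : Fin n → State → Coin → Option Msg → State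

namespace BroadcastAlgorithm

variable {n : ℕ}

instance (A : BroadcastAlgorithm n) : Countable A.Coin := A.countable_coin

instance (A : BroadcastAlgorithm n) : MeasurableSpace A.Coin := ⊤

/-- The random choices of all processes in all rounds: `ω r v` is the choice of `v` in round
`r + 1`. -/
abbrev Coins (A : BroadcastAlgorithm n) : Type := ℕ → Fin n → A.Coin

/-- The law of the random choices: they are independent, each with law `A.coinLaw`. -/
noncomputable def coinMeasure (A : BroadcastAlgorithm n) : Measure A.Coins :=
  Measure.infinitePi fun _ : ℕ => Measure.pi fun _ : Fin n => A.coinLaw.toMeasure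

/-- A configuration: the local state of each node, `none` for a node that has not yet received the
broadcast message. -/
abbrev Config (A : BroadcastAlgorithm n) : Type := Fin n → Option A.State

/-- The configuration at time `0`: only the source `s` is activated. -/
def start (A : BroadcastAlgorithm n) (s : Fin n) : A.Config :=
  fun v => if v = s then some (A.init v) else none

/-- The packets sent in a round; nodes that do not know the broadcast message remain silent. -/
def sent (A : BroadcastAlgorithm n) (x : A.Config) (c : Fin n → A.Coin) (u : Fin n) :
    Option A.Msg :=
  (x u).bind fun q => A.send u q (c u)

/-- One round with topology `G` and random choices `c`, started in the configuration `x`. -/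
noncomputable def step (A : BroadcastAlgorithm n) (G : SimpleGraph (Fin n)) (c : Fin n → A.Coin)
    (x : A.Config) : A.Config := fun v =>
  match x v with
  | none => (received G (A.sent x c) v).map (A.wake v)
  | some q => some (A.next v q (c v) (received G (A.sent x c) v))

/-- A strategy of the adversary: it determines the topology `G r ω` of round `r + 1`. -/
abbrev Adversary (A : BroadcastAlgorithm n) : Type := ℕ → A.Coins → SimpleGraph (Fin n)

/-- The adversary is `τ`-oblivious: the topology of the `r`-th round depends on the random choices
of the first `r - τ` rounds only (here with rounds numbered from `0`). -/
def Adversary.IsOblivious {A : BroadcastAlgorithm n} (G : A.Adversary) (τ : ℕ) : Prop :=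
  ∀ (r : ℕ) (ω ω' : A.Coins), (∀ j : ℕ, j + τ ≤ r → ω j = ω' j) → G r ω = G r ω'

/-- The configuration at time `t`, that is, after `t` rounds. -/
noncomputable def config (A : BroadcastAlgorithm n) (s : Fin n) (G : A.Adversary) (ω : A.Coins) :
    ℕ → A.Config
  | 0 => A.start s
  | t + 1 => A.step (G t ω) (ω t) (config A s G ω t)

/-- Broadcast from the source `s` is completed at time `t`: every node has received the broadcast
message. -/
def Completed (A : BroadcastAlgorithm n) (s : Fin n) (G : A.Adversary) (ω : A.Coins) (t : ℕ) :
    Prop :=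
  ∀ v : Fin n, A.config s G ω t v ≠ none

end BroadcastAlgorithm

/-! Time is cut into blocks of `L = min (min τ T) (n / k)` rounds. Since `L ≤ T`, one `k`-connected
graph `H` is present throughout a block; since `L ≤ τ`, the topologies of a block do not depend on
the coins tossed in it, so a block can be analysed for a fixed sequence of graphs. If exactly one
node of the whole network transmits, all its neighbors receive, so the edges outside `H` do no harm.
All progress is counted through such lone transmissions.

In the first half of a block, the set `S` of nodes informed earlier transmits with probability `1 /
(2n)` per node. A given set of `k / 2` of them produces a lone transmitter with probability of order
`Lk/n`. In the second half only the fresh nodes, informed in this block, transmit, with harmonically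
decreasing probabilities `4 / (4 + age)`. These sum to `O(log n)` per node, so while fewer than `m ≈
L / log n` nodes are fresh, interference is rare on average. A path of `H` outside `S` with fewer
than `m` edges, starting at a fresh node, is then traversed with probability at least `2/3`, unless
`m` nodes become fresh (`expect_path_not_activated_le`).

If `|S| ≥ k`, connectivity gives either `k / 2` nodes of `S` that each have `m` outside nodes within
reach, or `k / 2` suitable starting nodes for every outside node
(`KVertexConnected.reach_dichotomy`). Either way a block informs, in expectation, at least order
`(Lk/n) · min(m, |Sᶜ|)` nodes (`le_expect_card_fresh_block`). If `|S| < k`, at least `k - |S|`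
outside nodes have a neighbor in `S`, and each is informed with probability of order `L/n`. Hence
`potential`, the number of uninformed nodes plus `n` times the shortfall from `k`, loses in
expectation a fraction `δ` of order `Lkm/n²` per block (`expect_potential_le`). It starts at most at
`n²` and is at least `1` until completion, so by Markov's inequality `O(log n / δ)` blocks suffice.
The main term of the running time has only two logarithms; the third is slack. -/

set_option linter.unusedSectionVars false

/-! ### Reachability outside a set of vertices. -/

open Classical in
/-- The vertices of `U` that can be reached from `N ∩ U` by at most `i` steps inside `U`. -/
noncomputable def reach {V : Type*} (H : SimpleGraph V) (U N : Finset V) : ℕ → Finset V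
  | 0 => N ∩ U
  | i + 1 => reach H U N i ∪ U.filter fun v => ∃ w ∈ reach H U N i, H.Adj w v

section Reach

variable {V : Type*} {H : SimpleGraph V} {U N N' : Finset V}

theorem reach_subset (i : ℕ) : reach H U N i ⊆ U := by
  classical
  induction i with
  | zero => intro v hv; simp [reach] at hv; exact hv.2
  | succ i ih =>
    intro v hv
    simp only [reach, Finset.mem_union, Finset.mem_filter] at hv
    exact hv.elim (fun h => ih h) fun h => h.1

theorem reach_mono (h : ∀ v ∈ N, v ∈ U → v ∈ N') (i : ℕ) : reach H U N i ⊆ reach H U N' i := by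
  classical
  induction i with
  | zero =>
    intro v hv
    simp only [reach, Finset.mem_inter] at hv ⊢
    exact ⟨h v hv.1 hv.2, hv.2⟩
  | succ i ih =>
    intro v hv
    simp only [reach, Finset.mem_union, Finset.mem_filter] at hv ⊢
    rcases hv with hv | ⟨hv, w, hw, hwv⟩
    · exact Or.inl (ih hv)
    · exact Or.inr ⟨hv, w, ih hw, hwv⟩

theorem subset_reach {v : V} (hN : v ∈ N) (hU : v ∈ U) (i : ℕ) : v ∈ reach H U N i := by
  classical
  induction i with
  | zero => simp [reach, hN, hU]
  | succ i ih => simp only [reach, Finset.mem_union]; exact Or.inl ih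

theorem exists_path_of_mem_reach {i : ℕ} {u : V} (hu : u ∈ reach H U N i) :
    ∃ (l : ℕ) (w : ℕ → V), l ≤ i ∧ w 0 ∈ N ∧ w l = u ∧ (∀ j ≤ l, w j ∈ U) ∧
      ∀ j < l, H.Adj (w j) (w (j + 1)) := by
  classical
  induction i generalizing u with
  | zero =>
    simp only [reach, Finset.mem_inter] at hu
    exact ⟨0, fun _ => u, le_rfl, hu.1, rfl, fun _ _ => hu.2, by simp⟩
  | succ i ih =>
    simp only [reach, Finset.mem_union, Finset.mem_filter] at hu
    rcases hu with hu | ⟨hu, v, hv, hvu⟩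
    · obtain ⟨l, w, hl, h⟩ := ih hu
      exact ⟨l, w, by omega, h⟩
    · obtain ⟨l, w, hl, h0, h1, h2, h3⟩ := ih hv
      refine ⟨l + 1, fun j => if j ≤ l then w j else u, by omega, by simpa using h0, by simp, ?_, ?_⟩
      · intro j _
        by_cases hj : j ≤ l
        · simpa [hj] using h2 j hj
        · simpa [hj] using hu
      · intro j hj
        rcases Nat.lt_succ_iff_lt_or_eq.mp hj with hj | rfl
        · simpa [hj.le, Nat.succ_le_of_lt hj] using h3 j hj
        · simpa [h1] using hvu

/-- A set of reachable vertices that has not yet grown by one vertex per step is closed. -/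
theorem reach_closed_or_card (i : ℕ) :
    (∀ v ∈ reach H U N i, ∀ u ∈ U, H.Adj v u → u ∈ reach H U N i) ∨
      i + 1 ≤ (reach H U N i).card := by
  classical
  induction i with
  | zero =>
    by_cases h : N ∩ U = ∅
    · left; intro v hv; simp only [reach] at hv; rw [h] at hv; simp at hv
    · right
      have := Finset.card_pos.mpr (Finset.nonempty_iff_ne_empty.mpr h)
      simpa [reach] using this
  | succ i ih =>
    by_cases hc : ∀ v ∈ reach H U N i, ∀ u ∈ U, H.Adj v u → u ∈ reach H U N i
    · left
      have : reach H U N (i + 1) = reach H U N i := by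
        ext v
        simp only [reach, Finset.mem_union, Finset.mem_filter]
        exact ⟨fun h => h.elim id fun ⟨h1, w, hw, hwv⟩ => hc w hw v h1 hwv, Or.inl⟩
      rwa [this]
    · right
      have hi := ih.resolve_left hc
      push Not at hc
      obtain ⟨v, hv, u, hu, hvu, hn⟩ := hc
      have : (reach H U N i).card < (reach H U N (i + 1)).card := by
        apply Finset.card_lt_card
        refine ⟨fun w hw => ?_, fun h => hn (h ?_)⟩
        · simp only [reach, Finset.mem_union]; exact Or.inl hw
        · simp only [reach, Finset.mem_union, Finset.mem_filter]
          exact Or.inr ⟨hu, v, hv, hvu⟩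
      omega

end Reach

/-! ### Consequences of vertex connectivity. -/

section Connectivity

variable {V : Type*} [Fintype V] {H : SimpleGraph V} {k : ℕ}

/-- If fewer than `k` vertices are removed, a nonempty set of remaining vertices without edges to
the other remaining vertices consists of all of them. -/
theorem KVertexConnected.mem_of_closed (hH : KVertexConnected k H) (S : Finset V)
    (hS : S.card < k) (P : V → Prop) {v : V} (hv : v ∉ S) (hP : P v)
    (hcl : ∀ a b, P a → a ∉ S → b ∉ S → H.Adj a b → P b) {u : V} (hu : u ∉ S) : P u := by
  have hr := (hH.2 S hS).preconnected ⟨v, hv⟩ ⟨u, hu⟩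
  obtain ⟨p⟩ := hr
  have : ∀ (a b : {v : V | v ∉ S}) (_ : (H.induce {v : V | v ∉ S}).Walk a b), P a → P b := by
    intro a b p
    induction p with
    | nil => exact id
    | @cons a b c h p ih => exact fun ha => ih (hcl a b ha a.2 b.2 h)
  exact this _ _ p hP

open Classical in
/-- At least `k - |S|` vertices outside of `S` have a neighbor in `S`. -/
theorem KVertexConnected.card_frontier (hH : KVertexConnected k H) (S : Finset V)
    (hne : S.Nonempty) :
    k - S.card ≤ (Finset.univ.filter fun v => v ∉ S ∧ ∃ x ∈ S, H.Adj x v).card := by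
  set F := Finset.univ.filter fun v => v ∉ S ∧ ∃ x ∈ S, H.Adj x v with hF
  by_contra! hlt
  have hFk : F.card < k := by omega
  obtain ⟨s, hs⟩ := hne
  -- Removing the frontier `F` cuts `S` off from everything else, so `|F| < k` leaves nothing else.
  -- But then `|V| ≤ |S| + |F| < k`.
  have hcov : Finset.univ ⊆ S ∪ F := by
    intro u _
    by_cases hu : u ∈ F
    · simp [hu]
    · have := hH.mem_of_closed F hFk (fun v => v ∈ S) (v := s) (by simp [hF, hs]) hs
        (fun a b ha _ hb hab => by
          by_contra hbS
          exact hb (by simp only [hF, Finset.mem_filter, Finset.mem_univ, true_and]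
                       exact ⟨hbS, a, ha, hab⟩)) hu
      simp [this]
  have h1 := Finset.card_le_card hcov
  have h2 := Finset.card_union_le S F
  have h3 := hH.1
  rw [Finset.card_univ] at h1
  omega

open Classical in
/-- Either there are `k / 2` vertices of `S` from which `m` vertices outside of `S` can be reached
within `m` steps, or each vertex outside of `S` can be reached within `m` steps from `k / 2`
vertices of `S`. -/
theorem KVertexConnected.reach_dichotomy [DecidableEq V] (hH : KVertexConnected k H) (S : Finset V)
    (hSk : k ≤ S.card) (m : ℕ) :
    (∃ X ⊆ S, k ≤ 2 * X.card ∧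
      ∀ x ∈ X, m + 1 ≤ (reach H Sᶜ (Finset.univ.filter fun v => H.Adj x v) m).card) ∨
    ∀ v ∉ S, ∃ X ⊆ S, k ≤ 2 * X.card ∧
      ∀ x ∈ X, v ∈ reach H Sᶜ (Finset.univ.filter fun v => H.Adj x v) m := by
  set R : V → Finset V := fun x => reach H Sᶜ (Finset.univ.filter fun v => H.Adj x v) m with hR
  set Y := S.filter fun x => m + 1 ≤ (R x).card with hY
  by_cases hYk : k ≤ 2 * Y.card
  · left
    exact ⟨Y, Finset.filter_subset _ _, hYk, fun x hx => (Finset.mem_filter.mp hx).2⟩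
  right
  intro v hv
  -- `C` is the component of `v` outside `S`, and `T` its neighborhood in `S`. If `|T| < k`,
  -- removing `T` would separate `C` from a vertex of `S \ T`, which exists because `|S| ≥ k`.
  set C : V → Prop := Relation.ReflTransGen (fun a b => H.Adj a b ∧ b ∉ S) v with hC
  have hCS : ∀ z, C z → z ∉ S := by
    intro z hz
    rcases Relation.ReflTransGen.cases_tail hz with rfl | ⟨_, _, h⟩
    · exact hv
    · exact h.2
  set T := S.filter fun x => ∃ z, C z ∧ H.Adj x z with hT
  have hTk : k ≤ T.card := by
    by_contra! hlt
    have hTS : T ⊆ S := Finset.filter_subset _ _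
    obtain ⟨s, hs, hsT⟩ : ∃ s ∈ S, s ∉ T := Finset.exists_mem_notMem_of_card_lt_card (by omega)
    have := hH.mem_of_closed T hlt C (v := v) (fun h => hv (hTS h)) Relation.ReflTransGen.refl
      (fun a b ha _ hb hab => by
        by_cases hbS : b ∈ S
        · exact absurd (Finset.mem_filter.mpr ⟨hbS, a, ha, hab.symm⟩) hb
        · exact ha.tail ⟨hab, hbS⟩) hsT
    exact hCS s this hs
  refine ⟨T \ Y, fun x hx => (Finset.mem_filter.mp (Finset.mem_sdiff.mp hx).1).1, ?_, ?_⟩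
  · have := Finset.le_card_sdiff Y T
    omega
  · intro x hx
    obtain ⟨hxT, hxY⟩ := Finset.mem_sdiff.mp hx
    obtain ⟨hxS, z, hz, hxz⟩ := Finset.mem_filter.mp hxT
    -- The reachable set of a vertex in `T \ Y` is too small to have grown in every step, so it is
    -- closed; as it meets `C`, it contains `v`.
    have hcard : ¬ m + 1 ≤ (R x).card := fun h => hxY (Finset.mem_filter.mpr ⟨hxS, h⟩)
    have hcl := (reach_closed_or_card (H := H) (U := Sᶜ)
      (N := Finset.univ.filter fun v => H.Adj x v) m).resolve_right hcard
    have hzR : z ∈ R x := subset_reach (by simpa using hxz) (by simpa using hCS z hz) m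
    have hback : ∀ z, C z → z ∈ R x → v ∈ R x := by
      intro z hz
      induction hz with
      | refl => exact id
      | @tail b c hb hbc ih =>
        exact fun hc => ih (hcl c hc b (by simpa using hCS b hb) hbc.1.symm)
    exact hback z hz hzR

end Connectivity

/-! ### Activation times and their expected evolution for a fixed sequence of graphs. -/

section Evolution

variable {n : ℕ} {K : Type}

/-- In round `t`, with activation times `x` and random choices `c`, node `u` transmits; the set
`tx t a` consists of the random choices on which a node activated at time `a` transmits. -/
def Transmits (tx : ℕ → ℕ → Set K) (t : ℕ) (x : Fin n → Option ℕ) (c : Fin n → K)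
    (u : Fin n) : Prop :=
  ∃ a, x u = some a ∧ c u ∈ tx t a

/-- Node `u` is the only one that transmits. -/
def Lone (tx : ℕ → ℕ → Set K) (t : ℕ) (x : Fin n → Option ℕ) (c : Fin n → K)
    (u : Fin n) : Prop :=
  Transmits tx t x c u ∧ ∀ w, w ≠ u → ¬ Transmits tx t x c w

open Classical in
/-- The evolution of the activation times in one round. -/
noncomputable def advance (tx : ℕ → ℕ → Set K) (t : ℕ) (G : SimpleGraph (Fin n))
    (c : Fin n → K) (x : Fin n → Option ℕ) : Fin n → Option ℕ := fun v =>
  match x v with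
  | some a => some a
  | none => if ∃! u, G.Adj v u ∧ Transmits tx t x c u then some (t + 1) else none

variable {tx : ℕ → ℕ → Set K} {t : ℕ} {G : SimpleGraph (Fin n)} {c : Fin n → K}
  {x : Fin n → Option ℕ} {u v : Fin n}

theorem advance_of_some {a : ℕ} (h : x v = some a) : advance tx t G c x v = some a := by
  simp [advance, h]

theorem advance_of_none (h : x v = none) :
    advance tx t G c x v = none ∨ advance tx t G c x v = some (t + 1) := by
  simp only [advance, h]
  split_ifs <;> simp

theorem advance_ne_none (h : x v ≠ none) : advance tx t G c x v ≠ none := by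
  obtain ⟨a, ha⟩ := Option.ne_none_iff_exists'.mp h
  simp [advance_of_some ha]

theorem advance_eq_some {a : ℕ} (h : advance tx t G c x v = some a) :
    x v = some a ∨ x v = none ∧ a = t + 1 := by
  rcases hx : x v with _ | b
  · rcases advance_of_none (tx := tx) (t := t) (G := G) (c := c) hx with h' | h'
    · simp [h'] at h
    · rw [h'] at h; right; exact ⟨rfl, (Option.some.inj h).symm⟩
  · rw [advance_of_some hx] at h; exact Or.inl h

/-- With a single transmitter in the whole network there are no collisions, so only the edge to that
transmitter matters and not the rest of the topology. -/
theorem Lone.advance_eq (h : Lone tx t x c u) (hv : x v = none) (hG : G.Adj u v) :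
    advance tx t G c x v = some (t + 1) := by
  simp only [advance, hv]
  rw [if_pos]
  exact ⟨u, ⟨hG.symm, h.1⟩, fun w hw => by_contra fun hne => h.2 w hne hw.2⟩

theorem Lone.advance_ne_none (h : Lone tx t x c u) (hG : G.Adj u v) :
    advance tx t G c x v ≠ none := by
  by_cases hv : x v = none
  · simp [h.advance_eq hv hG]
  · exact _root_.advance_ne_none hv

variable [MeasurableSpace K] (ν : Measure K)

/-- The probability that `v` transmits. -/
noncomputable def rate (tx : ℕ → ℕ → Set K) (t : ℕ) (x : Fin n → Option ℕ) (v : Fin n) : ℝ :=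
  ν.real {k | ∃ a, x v = some a ∧ k ∈ tx t a}

theorem rate_of_some {a : ℕ} (h : x v = some a) : rate ν tx t x v = ν.real (tx t a) := by
  simp [rate, h]

theorem rate_of_none (h : x v = none) : rate ν tx t x v = 0 := by
  simp [rate, h]

theorem rate_nonneg : 0 ≤ rate ν tx t x v := measureReal_nonneg

theorem one_sub_sum_le_prod {ι : Type*} (s : Finset ι) (f : ι → ℝ) (h0 : ∀ i ∈ s, 0 ≤ f i)
    (h1 : ∀ i ∈ s, f i ≤ 1) : 1 - ∑ i ∈ s, f i ≤ ∏ i ∈ s, (1 - f i) := by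
  classical
  induction s using Finset.induction_on with
  | empty => simp
  | insert a s ha ih =>
    rw [Finset.sum_insert ha, Finset.prod_insert ha]
    have ih := ih (fun i hi => h0 i (by simp [hi])) (fun i hi => h1 i (by simp [hi]))
    have ha0 := h0 a (by simp)
    have ha1 := h1 a (by simp)
    have hs : 0 ≤ ∑ i ∈ s, f i := Finset.sum_nonneg fun i hi => h0 i (by simp [hi])
    nlinarith [mul_nonneg ha0 hs, mul_le_mul_of_nonneg_left ih (sub_nonneg.mpr ha1)]

variable [IsProbabilityMeasure ν]

theorem rate_le_one : rate ν tx t x v ≤ 1 := measureReal_le_one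

variable [DiscreteMeasurableSpace K]

/-- By independence the probability is the rate of `u` times the product of the silence
probabilities of the other nodes, to which the union bound applies. -/
theorem le_measureReal_lone (u : Fin n) :
    rate ν tx t x u * (1 - ∑ v ∈ Finset.univ.erase u, rate ν tx t x v) ≤
      (Measure.pi fun _ : Fin n => ν).real {c | Lone tx t x c u} := by
  classical
  set B : Fin n → Set K := fun v => {k | ∃ a, x v = some a ∧ k ∈ tx t a} with hB
  have hset : {c | Lone tx t x c u} =
      Set.pi Set.univ fun v => if v = u then B v else (B v)ᶜ := by
    ext c
    simp only [Set.mem_ofPred_eq, Set.mem_pi, Set.mem_univ, true_implies, Lone]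
    constructor
    · rintro ⟨h1, h2⟩ v
      split_ifs with h
      · subst h; exact h1
      · exact h2 v h
    · intro h
      refine ⟨(by have := h u; rwa [if_pos rfl] at this), fun w hw => ?_⟩
      have := h w
      rw [if_neg hw] at this
      exact this
  rw [hset, measureReal_def, Measure.pi_pi, ENNReal.toReal_prod]
  rw [← Finset.mul_prod_erase _ _ (Finset.mem_univ u)]
  simp only [if_true]
  refine mul_le_mul_of_nonneg_left ?_ (rate_nonneg ν)
  refine (one_sub_sum_le_prod _ _ (fun _ _ => rate_nonneg ν) (fun _ _ => rate_le_one ν)).trans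
    (le_of_eq ?_)
  refine Finset.prod_congr rfl fun v hv => ?_
  rw [if_neg (Finset.ne_of_mem_erase hv), ← measureReal_def,
    probReal_compl_eq_one_sub .of_discrete]
  rfl

variable [Finite K]

/-- At most one node can be lone, so these events are disjoint. -/
theorem measureReal_exists_lone (X : Finset (Fin n)) :
    (Measure.pi fun _ : Fin n => ν).real {c | ∃ u ∈ X, Lone tx t x c u} =
      ∑ u ∈ X, (Measure.pi fun _ : Fin n => ν).real {c | Lone tx t x c u} := by
  have : {c | ∃ u ∈ X, Lone tx t x c u} = ⋃ u ∈ X, {c | Lone tx t x c u} := by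
    ext c; simp
  rw [this, measureReal_biUnion_finset]
  · intro u _ v _ huv
    rw [Function.onFun, Set.disjoint_left]
    intro c hu hv
    exact hv.2 u huv hu.1
  · intro u _
    exact (Set.toFinite _).measurableSet

/-- The expected value of `φ` after `h` rounds, started at time `t` with activation times `x`. -/
noncomputable def expect (tx : ℕ → ℕ → Set K) (Γ : ℕ → SimpleGraph (Fin n))
    (φ : (Fin n → Option ℕ) → ℝ) : ℕ → ℕ → (Fin n → Option ℕ) → ℝ
  | 0, _, x => φ x
  | h + 1, t, x =>
    ∫ c, expect tx Γ φ h (t + 1) (advance tx t (Γ t) c x) ∂(Measure.pi fun _ : Fin n => ν)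

variable {Γ : ℕ → SimpleGraph (Fin n)} {φ ψ : (Fin n → Option ℕ) → ℝ}

theorem integrable_coins (f : (Fin n → K) → ℝ) :
    Integrable f (Measure.pi fun _ : Fin n => ν) := .of_finite

/-- Upper bounds by supermartingales, in the presence of an invariant. -/
theorem expect_le (I : ℕ → (Fin n → Option ℕ) → Prop) (Ψ : ℕ → (Fin n → Option ℕ) → ℝ) (h : ℕ)
    (t : ℕ) (x : Fin n → Option ℕ) (hx : I t x)
    (hI : ∀ s, t ≤ s → s < t + h → ∀ y, I s y → ∀ c : Fin n → K,
      I (s + 1) (advance tx s (Γ s) c y))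
    (hΨ : ∀ s, t ≤ s → s < t + h → ∀ y, I s y →
      ∫ c, Ψ (s + 1) (advance tx s (Γ s) c y) ∂(Measure.pi fun _ : Fin n => ν) ≤ Ψ s y)
    (hφ : ∀ y, I (t + h) y → φ y ≤ Ψ (t + h) y) :
    expect ν tx Γ φ h t x ≤ Ψ t x := by
  induction h generalizing t x with
  | zero => exact hφ x hx
  | succ h ih =>
    refine le_trans ?_ (hΨ t le_rfl (by omega) x hx)
    refine integral_mono (integrable_coins ν _) (integrable_coins ν _) fun c => ?_
    refine ih (t + 1) _ (hI t le_rfl (by omega) x hx c) (fun s h1 h2 => hI s (by omega) (by omega))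
      (fun s h1 h2 => hΨ s (by omega) (by omega)) ?_
    rw [show t + 1 + h = t + (h + 1) by ring]
    exact hφ

theorem expect_mono (I : ℕ → (Fin n → Option ℕ) → Prop) (h : ℕ)
    (t : ℕ) (x : Fin n → Option ℕ) (hx : I t x)
    (hI : ∀ s, t ≤ s → s < t + h → ∀ y, I s y → ∀ c : Fin n → K,
      I (s + 1) (advance tx s (Γ s) c y))
    (hφ : ∀ y, I (t + h) y → φ y ≤ ψ y) :
    expect ν tx Γ φ h t x ≤ expect ν tx Γ ψ h t x := by
  induction h generalizing t x with
  | zero => exact hφ x hx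
  | succ h ih =>
    refine integral_mono (integrable_coins ν _) (integrable_coins ν _) fun c => ?_
    refine ih (t + 1) _ (hI t le_rfl (by omega) x hx c) (fun s h1 h2 => hI s (by omega) (by omega))
      ?_
    rw [show t + 1 + h = t + (h + 1) by ring]
    exact hφ

theorem expect_const (r : ℝ) (h t : ℕ) (x : Fin n → Option ℕ) :
    expect ν tx Γ (fun _ => r) h t x = r := by
  induction h generalizing t x with
  | zero => rfl
  | succ h ih => simp [expect, ih]

theorem expect_add (h t : ℕ) (x : Fin n → Option ℕ) :
    expect ν tx Γ (fun y => φ y + ψ y) h t x =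
      expect ν tx Γ φ h t x + expect ν tx Γ ψ h t x := by
  induction h generalizing t x with
  | zero => rfl
  | succ h ih =>
    simp only [expect, ih]
    exact integral_add (integrable_coins ν _) (integrable_coins ν _)

theorem expect_const_mul (r : ℝ) (h t : ℕ) (x : Fin n → Option ℕ) :
    expect ν tx Γ (fun y => r * φ y) h t x = r * expect ν tx Γ φ h t x := by
  induction h generalizing t x with
  | zero => rfl
  | succ h ih =>
    simp only [expect, ih]
    exact integral_const_mul _ _

theorem expect_sum {ι : Type*} (s : Finset ι) (f : ι → (Fin n → Option ℕ) → ℝ) (h t : ℕ)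
    (x : Fin n → Option ℕ) :
    expect ν tx Γ (fun y => ∑ i ∈ s, f i y) h t x = ∑ i ∈ s, expect ν tx Γ (f i) h t x := by
  classical
  induction s using Finset.induction_on with
  | empty => simpa using expect_const ν 0 h t x
  | insert a s ha ih => simp only [Finset.sum_insert ha, expect_add, ih]

theorem expect_append (h h' t : ℕ) (x : Fin n → Option ℕ) :
    expect ν tx Γ φ (h + h') t x =
      expect ν tx Γ (fun y => expect ν tx Γ φ h' (t + h) y) h t x := by
  induction h generalizing t x with
  | zero => simp [expect]
  | succ h ih =>
    rw [show h + 1 + h' = (h + h') + 1 by ring]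
    simp only [expect, ih]
    simp only [show t + 1 + h = t + (h + 1) by ring]

/-- Changing the graphs outside of the rounds under consideration has no effect. -/
theorem expect_congr {Γ' : ℕ → SimpleGraph (Fin n)} (h t : ℕ) (x : Fin n → Option ℕ)
    (hΓ : ∀ s, t ≤ s → s < t + h → Γ s = Γ' s) :
    expect ν tx Γ φ h t x = expect ν tx Γ' φ h t x := by
  induction h generalizing t x with
  | zero => rfl
  | succ h ih =>
    simp only [expect, hΓ t le_rfl (by omega)]
    congr 1
    ext c
    exact ih _ _ fun s h1 h2 => hΓ s (by omega) (by omega)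

end Evolution

/-! ### First half of a block: lone transmissions of old nodes. -/

section Block

variable {n : ℕ} {K : Type} {tx : ℕ → ℕ → Set K} {Γ : ℕ → SimpleGraph (Fin n)}
  {H : SimpleGraph (Fin n)} {S : Finset (Fin n)} {x y : Fin n → Option ℕ} {b s : ℕ}

/-- At time `s`, exactly the nodes in `S` were activated at time `b` or before. -/
def ActivatedBy (S : Finset (Fin n)) (b s : ℕ) (y : Fin n → Option ℕ) : Prop :=
  (∀ v ∈ S, ∃ a ≤ b, y v = some a) ∧ ∀ v ∉ S, ∀ a, y v = some a → b < a ∧ a ≤ s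

theorem ActivatedBy.advance (hy : ActivatedBy S b s y) (hs : b ≤ s) (G : SimpleGraph (Fin n))
    (c : Fin n → K) : ActivatedBy S b (s + 1) (advance tx s G c y) := by
  refine ⟨fun v hv => ?_, fun v hv a ha => ?_⟩
  · obtain ⟨a, h1, h2⟩ := hy.1 v hv
    exact ⟨a, h1, advance_of_some h2⟩
  · rcases advance_eq_some ha with h | ⟨_, rfl⟩
    · have := hy.2 v hv a h
      omega
    · omega

open Classical in
/-- The activated nodes outside of `S`. -/
noncomputable def fresh (S : Finset (Fin n)) (y : Fin n → Option ℕ) : Finset (Fin n) :=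
  Finset.univ.filter fun v => v ∉ S ∧ y v ≠ none

theorem mem_fresh {v : Fin n} : v ∈ fresh S y ↔ v ∉ S ∧ y v ≠ none := by
  simp [fresh]

theorem fresh_subset_fresh_advance (G : SimpleGraph (Fin n)) (c : Fin n → K) :
    fresh S y ⊆ fresh S (advance tx s G c y) := by
  intro v hv
  rw [mem_fresh] at hv ⊢
  exact ⟨hv.1, advance_ne_none hv.2⟩

variable [MeasurableSpace K] (ν : Measure K) [IsProbabilityMeasure ν]
  [DiscreteMeasurableSpace K] [Finite K]

/-- The form of one supermartingale step: the bound `A` improves to `B` on the event of a useful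
lone transmission. -/
theorem integral_le_of_event (f : (Fin n → K) → ℝ) (A B : ℝ) (E : Set (Fin n → K))
    (hA : ∀ c, f c ≤ A) (hB : ∀ c ∈ E, f c ≤ B) :
    ∫ c, f c ∂(Measure.pi fun _ : Fin n => ν) ≤
      A - (A - B) * (Measure.pi fun _ : Fin n => ν).real E := by
  classical
  have hE : MeasurableSet E := (Set.toFinite _).measurableSet
  have h1 : ∫ c, f c ∂(Measure.pi fun _ : Fin n => ν) ≤
      ∫ c, (A - E.indicator (fun _ => A - B) c) ∂(Measure.pi fun _ : Fin n => ν) := by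
    refine integral_mono (integrable_coins ν _) (integrable_coins ν _) fun c => ?_
    by_cases hc : c ∈ E
    · simpa [hc] using hB c hc
    · simpa [hc] using hA c
  refine h1.trans (le_of_eq ?_)
  rw [integral_sub (integrable_coins ν _) (integrable_coins ν _), integral_indicator_const _ hE]
  simp [mul_comm]

open Classical in
/-- If the nodes in `S` transmit with probability `1 / (2 n)` and the other nodes are silent, then
some node in `X` soon activates all its neighbors. -/
theorem expect_not_exists_lone_le {X : Finset (Fin n)} (hX : X ⊆ S) (h : ℕ)
    (hold : ∀ s, b ≤ s → s < b + h → ∀ a ≤ b, ν.real (tx s a) = 1 / (2 * n))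
    (hnew : ∀ s, b ≤ s → s < b + h → ∀ a, b < a → tx s a = ∅)
    (hΓ : ∀ s, b ≤ s → s < b + h → H ≤ Γ s) (hx : ActivatedBy S b b x) :
    expect ν tx Γ (fun y => if ∃ u ∈ X, ∀ v, H.Adj u v → y v ≠ none then 0 else 1) h b x ≤
      (1 - X.card / (4 * n)) ^ h := by
  rcases Nat.eq_zero_or_pos n with rfl | hn
  · have : X = ∅ := Finset.eq_empty_of_isEmpty X
    subst this
    simpa using (expect_const ν 1 h b x).le
  have hn' : (0 : ℝ) < n := by exact_mod_cast hn
  set q : ℝ := 1 - X.card / (4 * n) with hq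
  have hXn : (X.card : ℝ) ≤ n := by
    have := Finset.card_le_univ X
    rw [Fintype.card_fin] at this
    exact_mod_cast this
  have hq0 : 0 ≤ q := by
    rw [hq, sub_nonneg, div_le_one (by positivity)]
    linarith
  -- The supermartingale is `0` after a success, and otherwise `q ^ r` with `r` the number of rounds
  -- left.
  have key := expect_le ν (Γ := Γ) (tx := tx)
    (φ := fun y => if ∃ u ∈ X, ∀ v, H.Adj u v → y v ≠ none then 0 else 1)
    (ActivatedBy S b)
    (fun s y => if ∃ u ∈ X, ∀ v, H.Adj u v → y v ≠ none then 0 else q ^ (b + h - s)) h b x hx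
    (fun s h1 _ y hy c => hy.advance h1 _ c) ?_ ?_
  · refine key.trans ?_
    simp only [Nat.add_sub_cancel_left]
    split_ifs
    · positivity
    · exact le_rfl
  · intro s h1 h2 y hy
    split_ifs with hg
    · refine le_of_eq (integral_eq_zero_of_ae (Filter.Eventually.of_forall fun c => ?_))
      obtain ⟨u, hu, h⟩ := hg
      exact if_pos ⟨u, hu, fun v hv => advance_ne_none (h v hv)⟩
    · refine (integral_le_of_event ν _ (q ^ (b + h - (s + 1))) 0
        {c | ∃ u ∈ X, Lone tx s y c u} ?_ ?_).trans ?_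
      · intro c
        split_ifs
        · positivity
        · exact le_rfl
      · rintro c ⟨u, hu, hc⟩
        exact le_of_eq (if_pos ⟨u, hu, fun v hv => hc.advance_ne_none (hΓ s h1 h2 hv)⟩)
      · rw [measureReal_exists_lone]
        have hrate : ∀ v, rate ν tx s y v ≤ 1 / (2 * n) := by
          intro v
          rcases hv : y v with _ | a
          · rw [rate_of_none ν hv]; positivity
          · rw [rate_of_some ν hv]
            by_cases ha : a ≤ b
            · rw [hold s h1 h2 a ha]
            · rw [hnew s h1 h2 a (by omega)]; simp
        -- The rates of the other nodes sum to at most `1 / 2`, so half of the probability `1 /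
        -- (2n)` of transmitting remains.
        have hlone : ∀ u ∈ X, 1 / (4 * n : ℝ) ≤
            (Measure.pi fun _ : Fin n => ν).real {c | Lone tx s y c u} := by
          intro u hu
          refine le_trans ?_ (le_measureReal_lone ν u)
          obtain ⟨a, ha, hua⟩ := hy.1 u (hX hu)
          rw [rate_of_some ν hua, hold s h1 h2 a ha]
          have hsum : ∑ v ∈ Finset.univ.erase u, rate ν tx s y v ≤ 1 / 2 := by
            refine (Finset.sum_le_sum fun v _ => hrate v).trans ?_
            rw [Finset.sum_const, nsmul_eq_mul]
            have : ((Finset.univ.erase u).card : ℝ) ≤ n := by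
              exact_mod_cast (Finset.card_le_univ _).trans (Fintype.card_fin n).le
            rw [mul_one_div, div_le_div_iff₀ (by positivity) (by norm_num)]
            linarith
          calc 1 / (4 * n : ℝ) = 1 / (2 * n) * (1 / 2) := by field_simp; norm_num
            _ ≤ _ := mul_le_mul_of_nonneg_left (by linarith) (by positivity)
        have := Finset.sum_le_sum hlone
        rw [Finset.sum_const, nsmul_eq_mul, mul_one_div] at this
        have e : b + h - s = (b + h - (s + 1)) + 1 := by omega
        rw [e, pow_succ]
        have hp : 0 ≤ q ^ (b + h - (s + 1)) := by positivity
        have := mul_le_mul_of_nonneg_left this hp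
        rw [hq]
        rw [hq] at this
        linarith
  · intro y _
    simp

/-- The sum of the transmission probabilities of a node over `r` rounds. -/
noncomputable def harmonicLoad (r : ℕ) : ℝ := ∑ i ∈ Finset.range r, 4 / (4 + (i : ℝ))

theorem harmonicLoad_mono : Monotone harmonicLoad := by
  intro i j hij
  exact Finset.sum_le_sum_of_subset_of_nonneg (Finset.range_subset_range.mpr hij)
    fun _ _ _ => by positivity

theorem harmonicLoad_nonneg (r : ℕ) : 0 ≤ harmonicLoad r :=
  Finset.sum_nonneg fun _ _ => by positivity

theorem harmonicLoad_succ (r : ℕ) : harmonicLoad (r + 1) = harmonicLoad r + 4 / (4 + (r : ℝ)) :=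
  Finset.sum_range_succ _ _

end Block

/-! ### Second half of a block: spreading along paths of fresh nodes. -/

section Spread

variable {n : ℕ} {K : Type} {tx : ℕ → ℕ → Set K} {Γ : ℕ → SimpleGraph (Fin n)}
  {H : SimpleGraph (Fin n)} {S : Finset (Fin n)} {x y : Fin n → Option ℕ} {b s d : ℕ}

/-- The number of rounds until time `s` in which `v` has been transmitting, if transmissions do not
begin before time `d`. -/
def age (d s : ℕ) (y : Fin n → Option ℕ) (v : Fin n) : ℕ := s - max ((y v).getD 0) d

/-- The sum of the transmission probabilities of all nodes over all rounds from `d` to `s`. -/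
noncomputable def totalLoad (S : Finset (Fin n)) (d s : ℕ) (y : Fin n → Option ℕ) : ℝ :=
  ∑ v ∈ fresh S y, harmonicLoad (age d s y v)

open Classical in
/-- The index of the last activated node of the path `w 0, …, w l`. -/
noncomputable def front (w : ℕ → Fin n) (l : ℕ) (y : Fin n → Option ℕ) : ℕ :=
  Nat.findGreatest (fun i => y (w i) ≠ none) l

theorem front_spec {w : ℕ → Fin n} {l : ℕ} (h : y (w 0) ≠ none) : y (w (front w l y)) ≠ none := by
  classical
  exact Nat.findGreatest_spec (P := fun i => y (w i) ≠ none) (Nat.zero_le l) h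

theorem front_le {w : ℕ → Fin n} {l : ℕ} : front w l y ≤ l := by
  classical
  exact Nat.findGreatest_le l

theorem le_front {w : ℕ → Fin n} {l i : ℕ} (hi : i ≤ l) (h : y (w i) ≠ none) :
    i ≤ front w l y := by
  classical
  exact Nat.le_findGreatest hi h

theorem eq_none_of_front_lt {w : ℕ → Fin n} {l i : ℕ} (hi : i ≤ l) (h : front w l y < i) :
    y (w i) = none := by
  by_contra hne
  exact absurd (le_front hi hne) (by omega)

theorem age_advance_of_ne_none {G : SimpleGraph (Fin n)} {c : Fin n → K} {v : Fin n}
    (hy : ActivatedBy S b s y) (hv : v ∈ fresh S y) (hs : d ≤ s) :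
    age d (s + 1) (advance tx s G c y) v = age d s y v + 1 := by
  rw [mem_fresh] at hv
  obtain ⟨a, ha⟩ := Option.ne_none_iff_exists'.mp hv.2
  have := hy.2 v hv.1 a ha
  simp only [age, advance_of_some ha, ha, Option.getD_some]
  omega

theorem age_advance_of_none {G : SimpleGraph (Fin n)} {c : Fin n → K} {v : Fin n}
    (hv : y v = none) (hv' : advance tx s G c y v ≠ none) :
    age d (s + 1) (advance tx s G c y) v = 0 := by
  have := (advance_of_none (tx := tx) (t := s) (G := G) (c := c) hv).resolve_left hv'
  simp only [age, this, Option.getD_some]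
  omega

variable [MeasurableSpace K] (ν : Measure K) [IsProbabilityMeasure ν]
  [DiscreteMeasurableSpace K] [Finite K]

theorem totalLoad_advance_ge {G : SimpleGraph (Fin n)} {c : Fin n → K}
    (hy : ActivatedBy S b s y) (hs : d ≤ s)
    (hnew : ∀ a, b < a → a ≤ s → ν.real (tx s a) = 4 / (4 + ((s - max a d : ℕ) : ℝ))) :
    totalLoad S d s y + ∑ v ∈ fresh S y, rate ν tx s y v ≤
      totalLoad S d (s + 1) (advance tx s G c y) := by
  have h1 : totalLoad S d s y + ∑ v ∈ fresh S y, rate ν tx s y v =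
      ∑ v ∈ fresh S y, harmonicLoad (age d (s + 1) (advance tx s G c y) v) := by
    rw [totalLoad, ← Finset.sum_add_distrib]
    refine Finset.sum_congr rfl fun v hv => ?_
    rw [age_advance_of_ne_none hy hv hs, harmonicLoad_succ]
    rw [mem_fresh] at hv
    obtain ⟨a, ha⟩ := Option.ne_none_iff_exists'.mp hv.2
    have := hy.2 v hv.1 a ha
    rw [rate_of_some ν ha, hnew a this.1 this.2]
    simp [age, ha]
  rw [h1]
  exact Finset.sum_le_sum_of_subset_of_nonneg (fresh_subset_fresh_advance G c)
    fun _ _ _ => harmonicLoad_nonneg _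

theorem totalLoad_le {h : ℕ} (hs : s ≤ d + h) :
    totalLoad S d s y ≤ (fresh S y).card * harmonicLoad h := by
  rw [← nsmul_eq_mul, ← Finset.sum_const]
  refine Finset.sum_le_sum fun v _ => harmonicLoad_mono ?_
  simp only [age]
  omega

theorem totalLoad_nonneg : 0 ≤ totalLoad S d s y :=
  Finset.sum_nonneg fun _ _ => harmonicLoad_nonneg _

open Classical in
/-- A path of length less than `m` starting in a fresh node is soon activated, unless `m` nodes are
fresh: supermartingale argument. -/
theorem expect_path_not_activated_le (m h l : ℕ) (w : ℕ → Fin n) (hl : l < m) (hbd : b ≤ d)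
    (hold : ∀ s, d ≤ s → s < d + h → ∀ a ≤ b, tx s a = ∅)
    (hnew : ∀ s, d ≤ s → s < d + h → ∀ a, b < a → a ≤ s →
      ν.real (tx s a) = 4 / (4 + ((s - max a d : ℕ) : ℝ)))
    (hΓ : ∀ s, d ≤ s → s < d + h → H ≤ Γ s)
    (hm : 3 * (m * (4 * harmonicLoad h + 3)) ≤ h)
    (hx : ActivatedBy S b d x) (hw0 : x (w 0) ≠ none) (hwS : ∀ i ≤ l, w i ∉ S)
    (hwH : ∀ i < l, H.Adj (w i) (w (i + 1))) :
    expect ν tx Γ (fun y => if y (w l) ≠ none ∨ m ≤ (fresh S y).card then 0 else 1) h d x ≤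
      1 / 3 := by
  -- `D` compensates the negative terms of the supermartingale below while fewer than `m` nodes are
  -- fresh.
  set D : ℝ := m * (4 * harmonicLoad h + 3) with hD
  have hm1 : (1 : ℝ) ≤ m := by exact_mod_cast (by omega : 1 ≤ m)
  have hL0 := harmonicLoad_nonneg h
  have hD0 : 0 < D := by positivity
  have hlm : (l : ℝ) + 1 ≤ m := by exact_mod_cast hl
  have hload : ∀ r : ℝ, r ≤ m → ∀ j : ℝ, j ≤ m → 0 ≤ D - 4 * (r * harmonicLoad h) - 3 * j := by
    intro r hr j hj
    have := mul_le_mul_of_nonneg_right hr hL0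
    rw [hD]
    linarith
  -- Per round, the elapsed time and the age of the front node add `1` each. If the front advances,
  -- its age is reset and the term `3 * front` grows, a gain of at least `age + 4` over standing
  -- still. A lone transmission of the front node causes this with probability at least `4 / (4 +
  -- age) * (1 - load)`. For `load ≤ 1 / 2` this pays for the `2`; for larger `load` the decrease by
  -- `4 * load` does. Failure costs at least `h` at the end, against at most `D ≤ h / 3` at the
  -- start.
  have key := expect_le ν (Γ := Γ) (tx := tx)
    (φ := fun y => h * (if y (w l) ≠ none ∨ m ≤ (fresh S y).card then 0 else 1))
    (fun s y => ActivatedBy S b s y ∧ y (w 0) ≠ none)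
    (fun s y => if y (w l) ≠ none ∨ m ≤ (fresh S y).card then 0 else
      D + age d s y (w (front w l y)) + (s - d : ℝ) - 4 * totalLoad S d s y - 3 * front w l y)
    h d x ⟨hx, hw0⟩
    (fun s h1 _ y hy c => ⟨hy.1.advance (by omega) _ c, advance_ne_none hy.2⟩) ?_ ?_
  · have h2 : expect ν tx Γ
        (fun y => h * (if y (w l) ≠ none ∨ m ≤ (fresh S y).card then 0 else 1)) h d x ≤ D := by
      refine key.trans ?_
      split_ifs
      · exact hD0.le
      · have ha : age d d x (w (front w l x)) = 0 := by simp only [age]; omega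
        have := totalLoad_nonneg (S := S) (d := d) (s := d) (y := x)
        rw [ha]
        push_cast
        nlinarith [Nat.cast_nonneg (α := ℝ) (front w l x)]
    rw [expect_const_mul] at h2
    have hh : (0 : ℝ) < h := by linarith
    rw [le_div_iff₀ (by norm_num)]
    by_contra! hlt
    nlinarith
  · rintro s h1 h2 y ⟨hy, hy0⟩
    split_ifs with hdone
    · refine le_of_eq (integral_eq_zero_of_ae (Filter.Eventually.of_forall fun c => ?_))
      refine if_pos (hdone.imp (fun h => advance_ne_none h) fun h => ?_)
      exact h.trans (Finset.card_le_card (fresh_subset_fresh_advance _ _))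
    · push Not at hdone
      obtain ⟨hyl, hcard⟩ := hdone
      set j := front w l y with hj
      have hjl : j < l := by
        refine lt_of_le_of_ne front_le fun h => ?_
        have := front_spec (l := l) hy0
        rw [← hj, h] at this
        exact this hyl
      have hjne : y (w j) ≠ none := front_spec hy0
      have hjS : w j ∈ fresh S y := mem_fresh.mpr ⟨hwS j hjl.le, hjne⟩
      set load : ℝ := ∑ v ∈ fresh S y, rate ν tx s y v with hloaddef
      -- `A` bounds the next value in all cases, `B` if the front advances: the new front node was
      -- then activated in this very round and has age `0`.
      set A : ℝ := D + (age d s y (w j) + 1) + (s + 1 - d : ℝ)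
        - 4 * (totalLoad S d s y + load) - 3 * j with hA
      set B : ℝ := D + (s + 1 - d : ℝ) - 4 * (totalLoad S d s y + load) - 3 * (j + 1) with hB
      have hds : (d : ℝ) ≤ s := by exact_mod_cast h1
      have hcardm : ((fresh S y).card : ℝ) ≤ m := by exact_mod_cast hcard.le
      have htot : totalLoad S d s y + load ≤ (fresh S y).card * harmonicLoad h := by
        have h3 : totalLoad S d s y + load = ∑ v ∈ fresh S y, harmonicLoad (age d s y v + 1) := by
          rw [totalLoad, ← Finset.sum_add_distrib]
          refine Finset.sum_congr rfl fun v hv => ?_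
          rw [harmonicLoad_succ]
          rw [mem_fresh] at hv
          obtain ⟨a, ha⟩ := Option.ne_none_iff_exists'.mp hv.2
          have := hy.2 v hv.1 a ha
          rw [rate_of_some ν ha, hnew s h1 h2 a this.1 this.2]
          simp [age, ha]
        rw [h3, ← nsmul_eq_mul, ← Finset.sum_const]
        refine Finset.sum_le_sum fun v _ => harmonicLoad_mono ?_
        simp only [age]
        omega
      have hjm : (j : ℝ) + 1 ≤ m := by exact_mod_cast (by omega : j + 1 ≤ m)
      have hB0 : 0 ≤ B := by
        have := hload _ hcardm _ hjm
        rw [hB]; linarith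
      have hage0 : (0 : ℝ) ≤ age d s y (w j) := Nat.cast_nonneg _
      have hBA : B ≤ A := by rw [hA, hB]; linarith
      have hfront : ∀ c : Fin n → K, j ≤ front w l (advance tx s (Γ s) c y) :=
        fun c => le_front hjl.le (advance_ne_none hjne)
      have htotal : ∀ c : Fin n → K, totalLoad S d s y + load ≤
          totalLoad S d (s + 1) (advance tx s (Γ s) c y) :=
        fun c => totalLoad_advance_ge ν hy h1 (hnew s h1 h2)
      have hlater : ∀ c : Fin n → K, j < front w l (advance tx s (Γ s) c y) →
          D + age d (s + 1) (advance tx s (Γ s) c y)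
              (w (front w l (advance tx s (Γ s) c y))) + ((s + 1 : ℕ) - d : ℝ) -
            4 * totalLoad S d (s + 1) (advance tx s (Γ s) c y) -
            3 * front w l (advance tx s (Γ s) c y) ≤ B := by
        intro c hlt
        rw [age_advance_of_none (eq_none_of_front_lt front_le hlt)
          (front_spec (advance_ne_none hy0))]
        have h4 := htotal c
        have h5 : (j : ℝ) + 1 ≤ front w l (advance tx s (Γ s) c y) := by exact_mod_cast hlt
        rw [hB]
        push_cast
        linarith
      refine (integral_le_of_event ν _ A B {c | Lone tx s y c (w j)} ?_ ?_).trans ?_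
      · intro c
        split_ifs
        · exact hB0.trans hBA
        · rcases (hfront c).lt_or_eq with hlt | heq
          · exact (hlater c hlt).trans hBA
          · rw [← heq, age_advance_of_ne_none hy hjS h1]
            have h4 := htotal c
            rw [hA]
            push_cast
            linarith
      · intro c hc
        split_ifs
        · exact hB0
        · refine hlater c (le_front (by omega) ?_)
          exact hc.advance_ne_none (hΓ s h1 h2 (hwH j hjl))
      · set P := (Measure.pi fun _ : Fin n => ν).real {c | Lone tx s y c (w j)} with hP
        have hP0 : 0 ≤ P := measureReal_nonneg
        have hAB : A - B = age d s y (w j) + 4 := by rw [hA, hB]; ring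
        have hmain : 2 - 4 * load ≤ (age d s y (w j) + 4) * P := by
          by_cases hl2 : 1 / 2 ≤ load
          · have : 0 ≤ (age d s y (w j) + 4) * P := by positivity
            linarith
          · have hle := le_measureReal_lone (tx := tx) (t := s) (x := y) ν (w j)
            rw [← hP] at hle
            have hsum : ∑ v ∈ Finset.univ.erase (w j), rate ν tx s y v ≤ load := by
              have h6 : ∑ v ∈ Finset.univ.erase (w j), rate ν tx s y v ≤
                  ∑ v, rate ν tx s y v :=
                Finset.sum_le_sum_of_subset_of_nonneg (Finset.erase_subset _ _)
                  fun _ _ _ => rate_nonneg ν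
              refine h6.trans (le_of_eq ?_)
              symm
              refine Finset.sum_subset (Finset.subset_univ _) fun v _ hv => ?_
              rcases hv' : y v with _ | a
              · exact rate_of_none ν hv'
              · rw [rate_of_some ν hv']
                have hvS : v ∈ S := by
                  by_contra hvS
                  exact hv (mem_fresh.mpr ⟨hvS, by simp [hv']⟩)
                obtain ⟨a', ha', hva'⟩ := hy.1 v hvS
                rw [hv'] at hva'
                obtain rfl := Option.some.inj hva'
                rw [hold s h1 h2 a ha']
                simp
            have hr : rate ν tx s y (w j) = 4 / (4 + (age d s y (w j) : ℝ)) := by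
              obtain ⟨a, ha⟩ := Option.ne_none_iff_exists'.mp hjne
              have := hy.2 _ (hwS j hjl.le) a ha
              rw [rate_of_some ν ha, hnew s h1 h2 a this.1 this.2]
              simp [age, ha]
            rw [hr] at hle
            have h7 : 4 / (4 + (age d s y (w j) : ℝ)) * (1 / 2) ≤ P :=
              le_trans (mul_le_mul_of_nonneg_left (by linarith) (by positivity)) hle
            have h8 := mul_le_mul_of_nonneg_left h7
              (by positivity : (0 : ℝ) ≤ age d s y (w j) + 4)
            have h9 : (age d s y (w j) + 4 : ℝ) * (4 / (4 + (age d s y (w j) : ℝ)) * (1 / 2)) =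
                2 := by
              field_simp
              ring
            have h10 : 0 ≤ load := Finset.sum_nonneg fun _ _ => rate_nonneg ν
            linarith
        rw [hAB, hA]
        linarith
  · rintro y ⟨hy, hy0⟩
    split_ifs with hdone
    · simp
    · push Not at hdone
      have h3 := totalLoad_le (S := S) (y := y) (le_refl (d + h))
      have h4 := hload (fresh S y).card (by exact_mod_cast hdone.2.le) (front w l y)
        (by exact_mod_cast (by have := front_le (w := w) (l := l) (y := y); omega))
      have h5 := Nat.cast_nonneg (α := ℝ) (age d (d + h) y (w (front w l y)))
      push_cast
      linarith

open Classical in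
/-- The expected number of fresh nodes is large if many nodes are close to fresh nodes. -/
theorem le_expect_card_fresh (m h : ℕ) (hm1 : 1 ≤ m) (hbd : b ≤ d)
    (hold : ∀ s, d ≤ s → s < d + h → ∀ a ≤ b, tx s a = ∅)
    (hnew : ∀ s, d ≤ s → s < d + h → ∀ a, b < a → a ≤ s →
      ν.real (tx s a) = 4 / (4 + ((s - max a d : ℕ) : ℝ)))
    (hΓ : ∀ s, d ≤ s → s < d + h → H ≤ Γ s)
    (hm : m = 1 ∨ 3 * (m * (4 * harmonicLoad h + 3)) ≤ h)
    (hx : ActivatedBy S b d x) :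
    (min m (reach H Sᶜ (fresh S x) (m - 1)).card : ℝ) / 3 ≤
      expect ν tx Γ (fun y => ((fresh S y).card : ℝ)) h d x := by
  set R := reach H Sᶜ (fresh S x) (m - 1) with hR
  have hfail : ∀ u ∈ R, expect ν tx Γ
      (fun y => if y u ≠ none ∨ m ≤ (fresh S y).card then 0 else 1) h d x ≤ 1 / 3 := by
    intro u hu
    obtain ⟨l, w, hl, h0, rfl, hwU, hwH⟩ := exists_path_of_mem_reach hu
    -- For `m = 1` only the fresh nodes themselves count as reachable, so no rounds are needed.
    rcases hm with rfl | hm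
    · obtain rfl : l = 0 := by omega
      refine (expect_le ν (fun _ y => y (w 0) ≠ none) (fun _ _ => 0) h d x (mem_fresh.mp h0).2
        (fun s _ _ y hy c => advance_ne_none hy) (by simp) ?_).trans (by norm_num)
      intro y hy
      simp [hy]
    · exact expect_path_not_activated_le ν m h l w (by omega) hbd hold hnew hΓ hm hx
        (mem_fresh.mp h0).2 (fun i hi => by simpa using hwU i hi) hwH
  set E := expect ν tx Γ (fun y => ((fresh S y).card : ℝ)) h d x with hE
  set β := expect ν tx Γ (fun y => if m ≤ (fresh S y).card then (1 : ℝ) else 0) h d x with hβ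
  have h1 : m * β ≤ E := by
    rw [hβ, ← expect_const_mul]
    refine expect_mono ν (fun _ _ => True) h d x trivial (by simp) fun y _ => ?_
    split_ifs with h
    · simpa using h
    · simp
  -- Each node of `R` ends up fresh, unless `m` nodes are fresh or its path has failed.
  have h2 : (R.card : ℝ) ≤ E + R.card * β + R.card * (1 / 3) := by
    have h3 : expect ν tx Γ (fun _ => (R.card : ℝ)) h d x ≤
        expect ν tx Γ (fun y => ((fresh S y).card : ℝ) +
          R.card * (if m ≤ (fresh S y).card then (1 : ℝ) else 0) +
          ∑ u ∈ R, if y u ≠ none ∨ m ≤ (fresh S y).card then (0 : ℝ) else 1) h d x := by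
      refine expect_mono ν (fun _ _ => True) h d x trivial (by simp) fun y _ => ?_
      have hsum : 0 ≤ ∑ u ∈ R, if y u ≠ none ∨ m ≤ (fresh S y).card then (0 : ℝ) else 1 :=
        Finset.sum_nonneg fun _ _ => by split_ifs <;> norm_num
      by_cases hc : m ≤ (fresh S y).card
      · simp [hc]
      · have h4 : R.card ≤ (fresh S y).card + (R.filter fun u => y u = none).card := by
          rw [← Finset.card_filter_add_card_filter_not (s := R) (fun u => y u = none), add_comm]
          refine Nat.add_le_add_right (Finset.card_le_card fun u hu => ?_) _
          rw [Finset.mem_filter] at hu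
          exact mem_fresh.mpr ⟨by simpa using reach_subset _ hu.1, hu.2⟩
        have h5 : ∑ u ∈ R, (if y u ≠ none ∨ m ≤ (fresh S y).card then (0 : ℝ) else 1) =
            (R.filter fun u => y u = none).card := by
          rw [Finset.card_filter]
          push_cast
          refine Finset.sum_congr rfl fun u _ => ?_
          by_cases hu : y u = none <;> simp [hu, hc]
        rw [h5, if_neg hc]
        simp only [mul_zero, add_zero]
        exact_mod_cast h4
    rw [expect_const, expect_add, expect_add, expect_const_mul, expect_sum] at h3
    refine h3.trans (add_le_add le_rfl ?_)
    rw [← nsmul_eq_mul, ← Finset.sum_const]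
    exact Finset.sum_le_sum hfail
  have hm1' : (1 : ℝ) ≤ m := by exact_mod_cast hm1
  have hR0 : (0 : ℝ) ≤ R.card := Nat.cast_nonneg _
  -- If `m` fresh nodes are likely, they alone give `m / 3`; otherwise at least a third of `R` is
  -- fresh in expectation.
  rcases le_or_gt (1 / 3) β with hb | hb
  · have := min_le_left (m : ℝ) R.card
    nlinarith
  · have := min_le_right (m : ℝ) R.card
    nlinarith

end Spread

/-- From `(1 - p) (1 + p) ≤ 1` and Bernoulli's inequality, the power is at most `1 / (1 + a p)`,
which is at most `1 - a p / 2` for `a p ≤ 1`. -/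
theorem one_sub_pow_le_one_sub_mul {p : ℝ} (hp0 : 0 ≤ p) (hp1 : p ≤ 1) {a : ℕ} (ha : a * p ≤ 1) :
    (1 - p) ^ a ≤ 1 - a * p / 2 := by
  have h1 : 1 + a * p ≤ (1 + p) ^ a := one_add_mul_le_pow (by linarith) a
  have h2 : (1 - p) ^ a * (1 + p) ^ a ≤ 1 := by
    rw [← mul_pow]
    exact pow_le_one₀ (by nlinarith) (by nlinarith)
  have h3 : 0 ≤ (1 - p) ^ a := pow_nonneg (by linarith) _
  have h4 : (0 : ℝ) ≤ a * p := by positivity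
  have h5 : (1 - p) ^ a * (1 + a * p) ≤ 1 := (mul_le_mul_of_nonneg_left h1 h3).trans h2
  by_contra! hlt
  nlinarith

/-! ### Expected decrease of the potential in one block. -/

section Drift

variable {n : ℕ} {K : Type} {tx : ℕ → ℕ → Set K} {Γ : ℕ → SimpleGraph (Fin n)}
  {H : SimpleGraph (Fin n)} {S : Finset (Fin n)} {x y : Fin n → Option ℕ} {b s : ℕ}

open Classical in
/-- The activated nodes. -/
noncomputable def informed (y : Fin n → Option ℕ) : Finset (Fin n) :=
  Finset.univ.filter fun v => y v ≠ none

theorem mem_informed {v : Fin n} : v ∈ informed y ↔ y v ≠ none := by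
  simp [informed]

theorem ActivatedBy.card_informed (hy : ActivatedBy S b s y) :
    (informed y).card = S.card + (fresh S y).card := by
  classical
  rw [← Finset.card_union_of_disjoint]
  · congr 1
    ext v
    simp only [Finset.mem_union, mem_informed, mem_fresh]
    by_cases hv : v ∈ S
    · obtain ⟨a, _, ha⟩ := hy.1 v hv
      simp [hv, ha]
    · simp [hv]
  · rw [Finset.disjoint_left]
    intro v hv hv'
    exact (mem_fresh.mp hv').1 hv

theorem ActivatedBy.fresh_eq_empty (hy : ActivatedBy S b b y) : fresh S y = ∅ := by
  rw [Finset.eq_empty_iff_forall_notMem]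
  intro v hv
  rw [mem_fresh] at hv
  obtain ⟨a, ha⟩ := Option.ne_none_iff_exists'.mp hv.2
  have := hy.2 v hv.1 a ha
  omega

/-- The potential function that measures the progress of the broadcast. -/
noncomputable def potential (k : ℕ) (y : Fin n → Option ℕ) : ℝ :=
  ((n : ℝ) - (informed y).card) + n * ((k - (informed y).card : ℕ) : ℝ)

variable [MeasurableSpace K] (ν : Measure K) [IsProbabilityMeasure ν]
  [DiscreteMeasurableSpace K] [Finite K]

-- A linearized form of the exponential bound. Replacing `|X|` by a smaller `r` keeps `h * r ≤ n`,
-- where linearization loses only a factor `2`.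
open Classical in
theorem expect_not_exists_lone_le' {X : Finset (Fin n)} (hX : X ⊆ S) (h : ℕ) {r : ℝ} (hr0 : 0 ≤ r)
    (hrX : r ≤ X.card) (hr : h * r ≤ n)
    (hold : ∀ s, b ≤ s → s < b + h → ∀ a ≤ b, ν.real (tx s a) = 1 / (2 * n))
    (hnew : ∀ s, b ≤ s → s < b + h → ∀ a, b < a → tx s a = ∅)
    (hΓ : ∀ s, b ≤ s → s < b + h → H ≤ Γ s) (hx : ActivatedBy S b b x) :
    expect ν tx Γ (fun y => if ∃ u ∈ X, ∀ v, H.Adj u v → y v ≠ none then 0 else 1) h b x ≤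
      1 - h * r / (8 * n) := by
  refine (expect_not_exists_lone_le ν hX h hold hnew hΓ hx).trans ?_
  have hXn : (X.card : ℝ) ≤ n := by
    have := Finset.card_le_univ X
    rw [Fintype.card_fin] at this
    exact_mod_cast this
  rcases Nat.eq_zero_or_pos n with rfl | hn
  · simp
  have hn' : (0 : ℝ) < n := by exact_mod_cast hn
  have h1 : r / (4 * n) ≤ X.card / (4 * n) := by gcongr
  have h2 : (X.card : ℝ) / (4 * n) ≤ 1 := by rw [div_le_one (by positivity)]; linarith
  calc (1 - X.card / (4 * n) : ℝ) ^ h ≤ (1 - r / (4 * n)) ^ h :=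
        pow_le_pow_left₀ (by linarith) (by linarith) _
    _ ≤ 1 - h * (r / (4 * n)) / 2 := by
        refine one_sub_pow_le_one_sub_mul (by positivity) (by linarith) ?_
        rw [← mul_div_assoc, div_le_one (by positivity)]
        linarith
    _ = 1 - h * r / (8 * n) := by ring

open Classical in
/-- In one block, the expected number of newly activated nodes is large. -/
theorem le_expect_card_fresh_block {k m a h : ℕ} (hm1 : 1 ≤ m)
    (hH : KVertexConnected k H) (hΓ : ∀ s, b ≤ s → s < b + (a + h) → H ≤ Γ s)
    (hold : ∀ s, b ≤ s → s < b + a → ∀ a' ≤ b, ν.real (tx s a') = 1 / (2 * n))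
    (hnew : ∀ s, b ≤ s → s < b + a → ∀ a', b < a' → tx s a' = ∅)
    (hold' : ∀ s, b + a ≤ s → s < b + a + h → ∀ a' ≤ b, tx s a' = ∅)
    (hnew' : ∀ s, b + a ≤ s → s < b + a + h → ∀ a', b < a' → a' ≤ s →
      ν.real (tx s a') = 4 / (4 + ((s - max a' (b + a) : ℕ) : ℝ)))
    (hm : m = 1 ∨ 3 * (m * (4 * harmonicLoad h + 3)) ≤ h)
    (hak : a * k ≤ n) (hx : ActivatedBy S b b x) (hSk : k ≤ S.card) :
    a * k / (48 * n) * min (m : ℝ) Sᶜ.card ≤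
      expect ν tx Γ (fun y => ((fresh S y).card : ℝ)) (a + h) b x := by
  set R : (Fin n → Option ℕ) → Finset (Fin n) :=
    fun y => reach H Sᶜ (fresh S y) (m - 1) with hR
  set E := expect ν tx Γ (fun y => min (m : ℝ) (R y).card) a b x with hE
  have h1 : 1 / 3 * E ≤ expect ν tx Γ (fun y => ((fresh S y).card : ℝ)) (a + h) b x := by
    rw [expect_append, hE, ← expect_const_mul]
    refine expect_mono ν (ActivatedBy S b) a b x hx (fun s hs _ y hy c => hy.advance hs _ c)
      fun y hy => ?_
    have := le_expect_card_fresh ν m h hm1 (Nat.le_add_right b a) hold' hnew'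
      (fun s h1 h2 => hΓ s (by omega) (by omega)) hm hy
    rw [hR]
    linarith
  -- This is the indicator of failure: it vanishes once some node of `X` has only activated
  -- neighbors in `H`.
  set good : Finset (Fin n) → (Fin n → Option ℕ) → ℝ :=
    fun X y => if ∃ u ∈ X, ∀ v, H.Adj u v → y v ≠ none then 0 else 1 with hgood
  have hfail : ∀ X ⊆ S, k ≤ 2 * X.card → expect ν tx Γ (good X) a b x ≤
      1 - a * k / (16 * n) := by
    intro X hX hkX
    have hkX' : (k : ℝ) ≤ 2 * X.card := by exact_mod_cast hkX
    have hak' : (a : ℝ) * k ≤ n := by exact_mod_cast hak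
    have := expect_not_exists_lone_le' ν (Γ := Γ) (H := H) hX a (r := k / 2) (by positivity)
      (by linarith)
      (by nlinarith [Nat.cast_nonneg (α := ℝ) a, Nat.cast_nonneg (α := ℝ) k]) hold hnew
      (fun s h1 h2 => hΓ s h1 (by omega)) hx
    refine this.trans (le_of_eq ?_)
    ring
  have hreach : ∀ u ∈ S, ∀ y : Fin n → Option ℕ, (∀ v, H.Adj u v → y v ≠ none) →
      reach H Sᶜ (Finset.univ.filter fun v => H.Adj u v) (m - 1) ⊆ R y := by
    intro u _ y hy
    refine reach_mono (fun v hv hvS => mem_fresh.mpr ⟨by simpa using hvS, hy v ?_⟩) _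
    simpa using hv
  have h2 : a * k / (16 * n) * min (m : ℝ) Sᶜ.card ≤ E := by
    rcases hH.reach_dichotomy S hSk (m - 1) with ⟨X, hX, hkX, hXm⟩ | hall
    · have h3 : expect ν tx Γ (fun y => m * (1 + -1 * good X y)) a b x ≤ E := by
        refine expect_mono ν (fun _ _ => True) a b x trivial (by simp) fun y _ => ?_
        simp only [hgood]
        split_ifs with hg
        · obtain ⟨u, hu, hy⟩ := hg
          have h4 := (hXm u hu).trans (Finset.card_le_card (hreach u (hX hu) y hy))
          rw [Nat.sub_add_cancel hm1] at h4
          have h5 : (m : ℝ) ≤ (R y).card := by exact_mod_cast h4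
          simp [h5]
        · simp
      rw [expect_const_mul, expect_add, expect_const, expect_const_mul] at h3
      have h4 := hfail X hX hkX
      have h5 : a * k / (16 * n) * min (m : ℝ) Sᶜ.card ≤ a * k / (16 * n) * (m : ℝ) :=
        mul_le_mul_of_nonneg_left (min_le_left _ _) (by positivity)
      have h6 := mul_le_mul_of_nonneg_left h4 (Nat.cast_nonneg (α := ℝ) m)
      linarith
    · choose! X hX hkX hXv using hall
      set M := min (m : ℝ) Sᶜ.card with hM
      have hM0 : 0 ≤ M := le_min (Nat.cast_nonneg _) (Nat.cast_nonneg _)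
      rcases Nat.eq_zero_or_pos Sᶜ.card with hS0 | hSpos
      · have h3 : M ≤ 0 := (min_le_right _ _).trans (by simp [hS0])
        have h4 : expect ν tx Γ (fun _ => (0 : ℝ)) a b x ≤ E :=
          expect_mono ν (fun _ _ => True) a b x trivial (by simp) fun y _ =>
            le_min (Nat.cast_nonneg _) (Nat.cast_nonneg _)
        rw [expect_const] at h4
        have h5 : M = 0 := le_antisymm h3 hM0
        rw [h5]
        simpa using h4
      have hS' : (0 : ℝ) < Sᶜ.card := by exact_mod_cast hSpos
      -- Here the starting sets `X v` vary with `v`. Since `|R y| ≤ |Sᶜ|`, the truncated size `min m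
      -- |R y|` is at least `M / |Sᶜ|` times `|R y|`, and linearity of expectation applies.
      have h3 : expect ν tx Γ (fun y => M * ∑ v ∈ Sᶜ, (1 + -1 * good (X v) y)) a b x ≤
          expect ν tx Γ (fun y => Sᶜ.card * min (m : ℝ) (R y).card) a b x := by
        refine expect_mono ν (fun _ _ => True) a b x trivial (by simp) fun y _ => ?_
        have hRS : ((R y).card : ℝ) ≤ Sᶜ.card := by
          exact_mod_cast Finset.card_le_card (reach_subset _)
        have hsum : ∑ v ∈ Sᶜ, (1 + -1 * good (X v) y) ≤ (R y).card := by
          have : ∑ v ∈ Sᶜ, (1 + -1 * good (X v) y) ≤ ∑ v ∈ Sᶜ, if v ∈ R y then (1 : ℝ) else 0 := by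
            refine Finset.sum_le_sum fun v hv => ?_
            have hv' : v ∉ S := by simpa using hv
            simp only [hgood]
            split_ifs with hg h7 h7
            · simp
            · obtain ⟨u, hu, hy⟩ := hg
              exact absurd (hreach u (hX v hv' hu) y hy (hXv v hv' u hu)) h7
            · simp
            · simp
          refine this.trans ?_
          rw [← Finset.sum_filter, Finset.sum_const, nsmul_eq_mul, mul_one]
          exact_mod_cast Finset.card_le_card fun v hv => (Finset.mem_filter.mp hv).2
        have h8 := mul_le_mul_of_nonneg_left hsum hM0
        refine h8.trans ?_
        rcases le_total (m : ℝ) (R y).card with hle | hle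
        · rw [min_eq_left hle, mul_comm]
          exact mul_le_mul hRS (min_le_left _ _) hM0 hS'.le
        · rw [min_eq_right hle]
          exact mul_le_mul_of_nonneg_right (min_le_right _ _) (Nat.cast_nonneg _)
      rw [expect_const_mul, expect_const_mul, expect_sum] at h3
      have h4 : Sᶜ.card * (a * k / (16 * n) : ℝ) ≤
          ∑ v ∈ Sᶜ, expect ν tx Γ (fun y => 1 + -1 * good (X v) y) a b x := by
        rw [← nsmul_eq_mul, ← Finset.sum_const]
        refine Finset.sum_le_sum fun v hv => ?_
        have hv' : v ∉ S := by simpa using hv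
        rw [expect_add, expect_const, expect_const_mul]
        linarith [hfail (X v) (hX v hv') (hkX v hv')]
      have h5 := (mul_le_mul_of_nonneg_left h4 hM0).trans h3
      refine le_of_mul_le_mul_left ?_ hS'
      linarith
  calc a * k / (48 * n) * min (m : ℝ) Sᶜ.card
      = 1 / 3 * (a * k / (16 * n) * min (m : ℝ) Sᶜ.card) := by ring
    _ ≤ 1 / 3 * E := by linarith
    _ ≤ _ := h1

open Classical in
/-- In one block, the potential decreases by a constant factor in expectation. -/
theorem expect_potential_le {k m a h : ℕ} (hm1 : 1 ≤ m)
    (hH : KVertexConnected k H) (hΓ : ∀ s, b ≤ s → s < b + (a + h) → H ≤ Γ s)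
    (hold : ∀ s, b ≤ s → s < b + a → ∀ a' ≤ b, ν.real (tx s a') = 1 / (2 * n))
    (hnew : ∀ s, b ≤ s → s < b + a → ∀ a', b < a' → tx s a' = ∅)
    (hold' : ∀ s, b + a ≤ s → s < b + a + h → ∀ a' ≤ b, tx s a' = ∅)
    (hnew' : ∀ s, b + a ≤ s → s < b + a + h → ∀ a', b < a' → a' ≤ s →
      ν.real (tx s a') = 4 / (4 + ((s - max a' (b + a) : ℕ) : ℝ)))
    (hm : m = 1 ∨ 3 * (m * (4 * harmonicLoad h + 3)) ≤ h)
    (hk : 1 ≤ k) (hak : a * k ≤ n) (hmk : m * k ≤ n)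
    (hx : ActivatedBy S b b x) (hS : S.Nonempty) :
    expect ν tx Γ (potential k) (a + h) b x ≤
      (1 - a * k * m / (48 * n ^ 2)) * potential k x := by
  have hkn : k < n := by simpa using hH.1
  have hn' : (0 : ℝ) < n := by exact_mod_cast (by omega : 0 < n)
  have hcx : (informed x).card = S.card := by
    rw [hx.card_informed, hx.fresh_eq_empty, Finset.card_empty, add_zero]
  have hSc : (Sᶜ.card : ℝ) = n - S.card := by
    rw [Finset.card_compl, Fintype.card_fin, Nat.cast_sub]
    simpa using Finset.card_le_univ S
  have hSc0 : (0 : ℝ) ≤ Sᶜ.card := Nat.cast_nonneg _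
  have hmk' : (m : ℝ) * k ≤ n := by exact_mod_cast hmk
  have hk' : (1 : ℝ) ≤ k := by exact_mod_cast hk
  have ha0 : (0 : ℝ) ≤ a := Nat.cast_nonneg _
  have hm0 : (0 : ℝ) ≤ m := Nat.cast_nonneg _
  rcases le_or_gt k S.card with hSk | hSk
  · have h1 := le_expect_card_fresh_block ν hm1 hH hΓ hold hnew hold' hnew' hm hak hx hSk
    have h2 : expect ν tx Γ (potential k) (a + h) b x ≤
        expect ν tx Γ (fun y => Sᶜ.card + -1 * ((fresh S y).card : ℝ)) (a + h) b x := by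
      refine expect_mono ν (ActivatedBy S b) _ b x hx (fun s hs _ y hy c => hy.advance hs _ c)
        fun y hy => ?_
      rw [potential, hy.card_informed, Nat.sub_eq_zero_of_le (by omega), hSc]
      push_cast
      linarith
    rw [expect_add, expect_const, expect_const_mul] at h2
    have h3 : potential k x = Sᶜ.card := by
      rw [potential, hcx, Nat.sub_eq_zero_of_le hSk, hSc]
      simp
    rw [h3]
    have hmn : (m : ℝ) ≤ n := le_trans (by nlinarith) hmk'
    have h4 : (m : ℝ) / n * Sᶜ.card ≤ min (m : ℝ) Sᶜ.card := by
      refine le_min ?_ ?_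
      · rw [div_mul_eq_mul_div, div_le_iff₀ hn']
        have := Nat.cast_nonneg (α := ℝ) S.card
        exact mul_le_mul_of_nonneg_left (by linarith) hm0
      · exact mul_le_of_le_one_left hSc0 ((div_le_one hn').mpr hmn)
    have h5 := mul_le_mul_of_nonneg_left h4 (by positivity : (0 : ℝ) ≤ a * k / (48 * n))
    have h6 : (a * k / (48 * n) * (m / n * Sᶜ.card) : ℝ) =
        a * k * m / (48 * n ^ 2) * Sᶜ.card := by
      field_simp
    linarith
  · set F := Finset.univ.filter fun v => v ∉ S ∧ ∃ u ∈ S, H.Adj u v with hF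
    -- Exactly `k - |S|` frontier nodes are selected, so that the shortfall term of the potential
    -- starts at `n * |W|` and later is at most `n` times the number of failing parents, counted per
    -- node of `W`.
    obtain ⟨W, hWF, hWc⟩ := Finset.exists_subset_card_eq (hH.card_frontier S hS)
    have hpar : ∀ v ∈ W, v ∉ S ∧ ∃ u ∈ S, H.Adj u v := fun v hv => by
      simpa [hF] using hWF hv
    choose! par hparS hparH using fun v hv => (hpar v hv).2
    set good : Fin n → (Fin n → Option ℕ) → ℝ :=
      fun u y => if ∃ u' ∈ ({u} : Finset (Fin n)), ∀ v, H.Adj u' v → y v ≠ none then 0 else 1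
      with hgood
    have hak1 : (a : ℝ) ≤ n := by
      exact_mod_cast (Nat.le_mul_of_pos_right a (by omega)).trans hak
    have hfail : ∀ u ∈ S, expect ν tx Γ (good u) (a + h) b x ≤ 1 - a / (8 * n) := by
      intro u hu
      rw [expect_append]
      have h1 := expect_not_exists_lone_le' ν (Γ := Γ) (H := H)
        (Finset.singleton_subset_iff.mpr hu) a (r := 1) zero_le_one (by simp)
        (by simpa using hak1) hold hnew (fun s h1 h2 => hΓ s h1 (by omega)) hx
      rw [mul_one] at h1
      refine le_trans ?_ h1
      refine expect_mono ν (fun _ _ => True) a b x trivial (by simp) fun y _ => ?_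
      split_ifs with hg
      · simp only [Finset.mem_singleton, exists_eq_left] at hg
        refine expect_le ν (fun _ y => ∀ v, H.Adj u v → y v ≠ none) (fun _ _ => 0) h _ y hg
          (fun s _ _ y hy c v hv => advance_ne_none (hy v hv)) (by simp) fun y hy => ?_
        simp only [hgood, Finset.mem_singleton, exists_eq_left]
        rw [if_pos hy]
      · refine expect_le ν (fun _ _ => True) (fun _ _ => 1) h _ y trivial (by simp) (by simp)
          fun y _ => ?_
        simp only [hgood]
        split_ifs <;> norm_num
    have h2 : expect ν tx Γ (potential k) (a + h) b x ≤
        expect ν tx Γ (fun y => Sᶜ.card + n * ∑ v ∈ W, good (par v) y) (a + h) b x := by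
      refine expect_mono ν (ActivatedBy S b) _ b x hx (fun s hs _ y hy c => hy.advance hs _ c)
        fun y hy => ?_
      have h3 : W.card ≤ (fresh S y).card + (W.filter fun v => y v = none).card := by
        rw [← Finset.card_filter_add_card_filter_not (s := W) (fun u => y u = none), add_comm]
        refine Nat.add_le_add_right (Finset.card_le_card fun v hv => ?_) _
        rw [Finset.mem_filter] at hv
        exact mem_fresh.mpr ⟨(hpar v hv.1).1, hv.2⟩
      have h4 : ((W.filter fun v => y v = none).card : ℝ) ≤ ∑ v ∈ W, good (par v) y := by
        rw [Finset.card_filter]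
        push_cast
        refine Finset.sum_le_sum fun v hv => ?_
        simp only [hgood, Finset.mem_singleton, exists_eq_left]
        split_ifs with h5 h6
        · exact absurd h5 (h6 v (hparH v hv))
        · exact le_rfl
        · exact le_rfl
        · exact zero_le_one
      have h5 : k - (informed y).card ≤ (W.filter fun v => y v = none).card := by
        rw [hy.card_informed]; omega
      have h6 : ((k - (informed y).card : ℕ) : ℝ) ≤ ∑ v ∈ W, good (par v) y :=
        le_trans (by exact_mod_cast h5) h4
      have h7 := mul_le_mul_of_nonneg_left h6 hn'.le
      rw [potential, hSc, hy.card_informed] at *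
      push_cast at *
      have := Nat.cast_nonneg (α := ℝ) (fresh S y).card
      linarith
    rw [expect_add, expect_const, expect_const_mul, expect_sum] at h2
    have h3 : ∑ v ∈ W, expect ν tx Γ (good (par v)) (a + h) b x ≤ W.card * (1 - a / (8 * n)) := by
      rw [← nsmul_eq_mul, ← Finset.sum_const]
      exact Finset.sum_le_sum fun v hv => hfail _ (hparS v hv)
    have h4 : potential k x = Sᶜ.card + n * (W.card : ℝ) := by
      rw [potential, hcx, hSc, hWc]
    rw [h4]
    have hW1 : (1 : ℝ) ≤ W.card := by exact_mod_cast (by omega : 1 ≤ W.card)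
    have hδ : (a * k * m / (48 * n ^ 2) : ℝ) ≤ a / (48 * n) := by
      rw [div_le_div_iff₀ (by positivity) (by positivity)]
      have := mul_le_mul_of_nonneg_left hmk' (by positivity : (0 : ℝ) ≤ a * 48 * n)
      nlinarith
    -- The weight `n` makes the shortfall term dominate as long as `|W| ≥ 1`.
    have hScn : (Sᶜ.card : ℝ) ≤ n * W.card := by
      have := Nat.cast_nonneg (α := ℝ) S.card
      nlinarith
    have h5 := mul_le_mul_of_nonneg_left h3 hn'.le
    have h6 : (0 : ℝ) ≤ Sᶜ.card + n * (W.card : ℝ) := by positivity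
    have h7 := mul_le_mul_of_nonneg_right hδ h6
    have h8 : (a / (48 * n) : ℝ) * (Sᶜ.card + n * (W.card : ℝ)) ≤
        a / (48 * n) * (2 * (n * W.card)) :=
      mul_le_mul_of_nonneg_left (by linarith) (by positivity)
    have h9 : (0 : ℝ) ≤ a / (48 * n) * (n * W.card) := by positivity
    have h10 : (n * (W.card * (1 - a / (8 * n))) : ℝ) =
        n * W.card - 6 * (a / (48 * n) * (n * W.card)) := by
      field_simp
      ring
    linarith

end Drift

/-! ### Resampling a coordinate of an infinite product. -/

section InfiniteProduct

variable {X : Type*} [MeasurableSpace X] (P : Measure X) [IsProbabilityMeasure P]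

/-- Resampling one coordinate preserves an infinite product measure. -/
theorem measurePreserving_update (t : ℕ) :
    MeasurePreserving (fun p : (ℕ → X) × X => Function.update p.1 t p.2)
      ((Measure.infinitePi fun _ : ℕ => P).prod P) (Measure.infinitePi fun _ : ℕ => P) := by
  classical
  have hmeas : Measurable fun p : (ℕ → X) × X => Function.update p.1 t p.2 := by
    refine measurable_pi_lambda _ fun j => ?_
    by_cases hj : j = t
    · subst hj; simpa using measurable_snd
    · simp only [Function.update_of_ne hj]
      exact (measurable_pi_apply j).comp measurable_fst
  refine ⟨hmeas, Measure.eq_infinitePi _ fun s B hB => ?_⟩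
  rw [Measure.map_apply hmeas (MeasurableSet.pi s.countable_toSet fun i _ => hB i)]
  have hset : (fun p : (ℕ → X) × X => Function.update p.1 t p.2) ⁻¹' Set.pi s B =
      Set.pi (s.erase t : Finset ℕ) B ×ˢ (if t ∈ s then B t else Set.univ) := by
    ext ⟨ω, c⟩
    simp only [Set.mem_preimage, Set.mem_pi, Set.mem_prod, Finset.mem_coe, Finset.mem_erase]
    constructor
    · intro h
      refine ⟨fun j hj => by simpa [Function.update_of_ne hj.1] using h j hj.2, ?_⟩
      split_ifs with ht
      · simpa using h t ht
      · trivial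
    · rintro ⟨h1, h2⟩ j hj
      by_cases hjt : j = t
      · subst hjt
        rw [if_pos hj] at h2
        simpa using h2
      · simpa [Function.update_of_ne hjt] using h1 j ⟨hjt, hj⟩
  rw [hset, Measure.prod_prod, Measure.infinitePi_pi _ fun i _ => hB i]
  by_cases ht : t ∈ s
  · rw [if_pos ht, Finset.prod_erase_mul _ _ ht]
  · rw [if_neg ht, measure_univ, mul_one, Finset.erase_eq_of_notMem ht]

/-- The function `f` depends on the coordinates before `r` only. -/
def DependsBefore {X β : Type*} (r : ℕ) (f : (ℕ → X) → β) : Prop :=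
  ∀ ω ω' : ℕ → X, (∀ j < r, ω j = ω' j) → f ω = f ω'

variable [Finite X] [DiscreteMeasurableSpace X]

/-- Factoring through finitely many coordinates, with finitely many values each, settles all
measurability and integrability questions. -/
theorem DependsBefore.exists_eq_comp {β : Type*} {r : ℕ} {f : (ℕ → X) → β} [Nonempty X]
    (hf : DependsBefore r f) : ∃ g : (Fin r → X) → β, f = g ∘ fun ω j => ω j := by
  refine ⟨fun z => f fun j => if h : j < r then z ⟨j, h⟩ else Classical.arbitrary X, ?_⟩
  ext ω
  refine hf _ _ fun j hj => ?_
  simp [hj]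

theorem DependsBefore.integrable {r : ℕ} {f : (ℕ → X) → ℝ} (hf : DependsBefore r f) :
    Integrable f (Measure.infinitePi fun _ : ℕ => P) := by
  have : Nonempty X := P.nonempty_of_neZero
  obtain ⟨g, rfl⟩ := hf.exists_eq_comp
  have hm : Measurable fun (ω : ℕ → X) (j : Fin r) => ω j := by fun_prop
  have := Measure.isProbabilityMeasure_map (μ := Measure.infinitePi fun _ : ℕ => P) hm.aemeasurable
  exact Integrable.comp_measurable (Integrable.of_finite) hm

theorem DependsBefore.measurableSet {r : ℕ} {p : (ℕ → X) → Prop} (hp : DependsBefore r p)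
    [Nonempty X] : MeasurableSet {ω | p ω} := by
  obtain ⟨g, rfl⟩ := hp.exists_eq_comp
  have hm : Measurable fun (ω : ℕ → X) (j : Fin r) => ω j := by fun_prop
  exact hm (Set.toFinite {z | g z}).measurableSet

theorem DependsBefore.integral_eq {r : ℕ} {f : (ℕ → X) → ℝ} (hf : DependsBefore r f) (t : ℕ) :
    ∫ ω, f ω ∂(Measure.infinitePi fun _ : ℕ => P) =
      ∫ ω, ∫ c, f (Function.update ω t c) ∂P ∂(Measure.infinitePi fun _ : ℕ => P) := by
  have hmp := measurePreserving_update P t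
  have hint := hf.integrable P
  rw [← integral_prod (fun p : (ℕ → X) × X => f (Function.update p.1 t p.2))
    (hmp.integrable_comp_of_integrable hint)]
  conv_lhs => rw [← hmp.map_eq]
  rw [integral_map hmp.measurable.aemeasurable]
  rw [hmp.map_eq]
  exact hint.aestronglyMeasurable

end InfiniteProduct

/-! ### The process against an oblivious adversary. -/

section Trajectory

variable {n : ℕ} {K : Type} (tx : ℕ → ℕ → Set K) (src : Fin n)
  (G : ℕ → (ℕ → Fin n → K) → SimpleGraph (Fin n))

/-- The activation times at time `t`. -/
noncomputable def activation (ω : ℕ → Fin n → K) : ℕ → Fin n → Option ℕ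
  | 0 => fun v => if v = src then some 0 else none
  | t + 1 => advance tx t (G t ω) (ω t) (activation ω t)

variable {tx src G} {τ : ℕ}

theorem activation_le {ω : ℕ → Fin n → K} {t a : ℕ} {v : Fin n}
    (h : activation tx src G ω t v = some a) : a ≤ t := by
  induction t with
  | zero =>
    simp only [activation] at h
    split_ifs at h
    obtain rfl := Option.some.inj h
    exact le_rfl
  | succ t ih =>
    rcases advance_eq_some h with h | ⟨_, rfl⟩
    · exact (ih h).trans (Nat.le_succ t)
    · exact le_rfl

theorem activation_source (ω : ℕ → Fin n → K) (t : ℕ) : activation tx src G ω t src ≠ none := by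
  induction t with
  | zero => simp [activation]
  | succ t ih => exact advance_ne_none ih

theorem activatedBy_activation (ω : ℕ → Fin n → K) (t : ℕ) :
    ActivatedBy (informed (activation tx src G ω t)) t t (activation tx src G ω t) := by
  refine ⟨fun v hv => ?_, fun v hv a ha => ?_⟩
  · obtain ⟨a, ha⟩ := Option.ne_none_iff_exists'.mp (mem_informed.mp hv)
    exact ⟨a, activation_le ha, ha⟩
  · exact absurd (mem_informed.mpr (by simp [ha])) hv

theorem dependsBefore_activation (hτ : 1 ≤ τ)
    (hG : ∀ r ω ω', (∀ j, j + τ ≤ r → ω j = ω' j) → G r ω = G r ω') (t : ℕ) :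
    DependsBefore t fun ω => activation tx src G ω t := by
  intro ω ω' h
  induction t with
  | zero => rfl
  | succ t ih =>
    have h1 := ih fun j hj => h j (by omega)
    simp only [activation] at h1 ⊢
    rw [h1, hG t ω ω' (fun j hj => h j (by omega)), h t (by omega)]

variable [MeasurableSpace K] (ν : Measure K) [IsProbabilityMeasure ν]
  [DiscreteMeasurableSpace K] [Finite K]

/-- During `L ≤ τ` rounds, the network does not react to the random choices of these rounds. -/
theorem integral_activation_add (hτ : 1 ≤ τ)
    (hG : ∀ r ω ω', (∀ j, j + τ ≤ r → ω j = ω' j) → G r ω = G r ω')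
    (φ : (Fin n → Option ℕ) → ℝ) (b L : ℕ) (hL : L ≤ τ) :
    ∫ ω, φ (activation tx src G ω (b + L))
        ∂(Measure.infinitePi fun _ : ℕ => Measure.pi fun _ : Fin n => ν) =
      ∫ ω, expect ν tx (fun t => G t ω) φ L b (activation tx src G ω b)
        ∂(Measure.infinitePi fun _ : ℕ => Measure.pi fun _ : Fin n => ν) := by
  -- Rounds are peeled off from the end by resampling the coins of round `t ≥ b`. The topologies of
  -- rounds before `b + L ≤ b + τ` depend only on coins before `b`, so they are unaffected.
  have key : ∀ j t, t + j = b + L → b ≤ t →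
      ∫ ω, φ (activation tx src G ω (b + L))
        ∂(Measure.infinitePi fun _ : ℕ => Measure.pi fun _ : Fin n => ν) =
      ∫ ω, expect ν tx (fun t => G t ω) φ j t (activation tx src G ω t)
        ∂(Measure.infinitePi fun _ : ℕ => Measure.pi fun _ : Fin n => ν) := by
    intro j
    induction j with
    | zero => rintro t ht -; simp only [add_zero] at ht; subst ht; rfl
    | succ j ih =>
      intro t ht hbt
      rw [ih (t + 1) (by omega) (by omega)]
      have hdep : DependsBefore (b + L) fun ω =>
          expect ν tx (fun t => G t ω) φ j (t + 1) (activation tx src G ω (t + 1)) := by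
        intro ω ω' h
        simp only
        rw [show activation tx src G ω (t + 1) = activation tx src G ω' (t + 1) from
          dependsBefore_activation hτ hG (t + 1) ω ω' fun i hi => h i (by omega)]
        exact expect_congr ν j (t + 1) _ fun s h1 h2 => hG s ω ω' fun i hi => h i (by omega)
      rw [hdep.integral_eq _ t]
      congr 1
      ext ω
      rw [expect]
      congr 1
      ext c
      have hact : activation tx src G (Function.update ω t c) (t + 1) =
          advance tx t (G t ω) c (activation tx src G ω t) := by
        rw [activation]
        rw [show activation tx src G (Function.update ω t c) t = activation tx src G ω t from
          dependsBefore_activation hτ hG t _ _ fun i hi => by rw [Function.update_of_ne (by omega)]]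
        rw [hG t (Function.update ω t c) ω fun i hi => by rw [Function.update_of_ne (by omega)]]
        simp
      rw [hact]
      exact expect_congr ν j (t + 1) _ fun s h1 h2 =>
        hG s _ _ fun i hi => by rw [Function.update_of_ne (by omega)]
  exact key L b rfl le_rfl

/-- Exponential decay of the expected potential. -/
theorem integral_potential_le {k L : ℕ} {δ : ℝ} (hδ : δ ≤ 1) (hτ : 1 ≤ τ) (hL : L ≤ τ)
    (hG : ∀ r ω ω', (∀ j, j + τ ≤ r → ω j = ω' j) → G r ω = G r ω')
    (hstep : ∀ (i : ℕ) (ω : ℕ → Fin n → K) (S : Finset (Fin n)) (x : Fin n → Option ℕ),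
      S.Nonempty → ActivatedBy S (i * L) (i * L) x →
      expect ν tx (fun t => G t ω) (potential k) L (i * L) x ≤ (1 - δ) * potential k x)
    (i : ℕ) :
    ∫ ω, potential k (activation tx src G ω (i * L))
        ∂(Measure.infinitePi fun _ : ℕ => Measure.pi fun _ : Fin n => ν) ≤
      (1 - δ) ^ i * (n + n * k) := by
  have hint : ∀ t, Integrable (fun ω => potential k (activation tx src G ω t))
      (Measure.infinitePi fun _ : ℕ => Measure.pi fun _ : Fin n => ν) := by
    intro t
    refine DependsBefore.integrable (r := t) _ fun ω ω' h => ?_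
    rw [show activation tx src G ω t = activation tx src G ω' t from
      dependsBefore_activation hτ hG t ω ω' h]
  induction i with
  | zero =>
    have h1 : ∀ y : Fin n → Option ℕ, potential k y ≤ n + n * k := by
      intro y
      rw [potential]
      have h2 : ((k - (informed y).card : ℕ) : ℝ) ≤ k := by exact_mod_cast Nat.sub_le _ _
      have h3 := Nat.cast_nonneg (α := ℝ) (informed y).card
      have h4 := mul_le_mul_of_nonneg_left h2 (Nat.cast_nonneg (α := ℝ) n)
      linarith
    refine (integral_mono (hint _) (integrable_const (n + n * k : ℝ)) fun ω => h1 _).trans ?_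
    simp
  | succ i ih =>
    rw [Nat.succ_mul, integral_activation_add ν hτ hG _ _ _ hL]
    have hint2 : Integrable (fun ω => expect ν tx (fun t => G t ω) (potential k) L (i * L)
        (activation tx src G ω (i * L)))
        (Measure.infinitePi fun _ : ℕ => Measure.pi fun _ : Fin n => ν) := by
      refine DependsBefore.integrable (r := i * L + L) _ fun ω ω' h => ?_
      rw [show activation tx src G ω (i * L) = activation tx src G ω' (i * L) from
        dependsBefore_activation hτ hG _ ω ω' fun j hj => h j (by omega)]
      exact expect_congr ν _ _ _ fun s h1 h2 => hG s ω ω' fun j hj => h j (by omega)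
    refine (integral_mono hint2 ((hint (i * L)).const_mul (1 - δ)) fun ω => ?_).trans ?_
    · exact hstep i ω _ _ ⟨src, mem_informed.mpr (activation_source ω _)⟩
        (activatedBy_activation ω _)
    · rw [integral_const_mul, pow_succ]
      have := mul_le_mul_of_nonneg_left ih (sub_nonneg.mpr hδ)
      linarith

/-- The broadcast is completed with the probability that the expected potential yields. -/
theorem one_sub_integral_potential_le {k : ℕ} (hτ : 1 ≤ τ)
    (hG : ∀ r ω ω', (∀ j, j + τ ≤ r → ω j = ω' j) → G r ω = G r ω') (t : ℕ) :
    1 - ∫ ω, potential k (activation tx src G ω t)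
        ∂(Measure.infinitePi fun _ : ℕ => Measure.pi fun _ : Fin n => ν) ≤
      (Measure.infinitePi fun _ : ℕ => Measure.pi fun _ : Fin n => ν).real
        {ω | ∀ v, activation tx src G ω t v ≠ none} := by
  classical
  set μ := Measure.infinitePi fun _ : ℕ => Measure.pi fun _ : Fin n => ν with hμ
  have hne : Nonempty K := ν.nonempty_of_neZero
  have hdep : DependsBefore t fun ω => ∀ v, activation tx src G ω t v ≠ none := by
    intro ω ω' h
    simp only
    rw [show activation tx src G ω t = activation tx src G ω' t from
      dependsBefore_activation hτ hG t ω ω' h]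
  have hm : MeasurableSet {ω | ∀ v, activation tx src G ω t v ≠ none} := hdep.measurableSet
  have hint : Integrable (fun ω => potential k (activation tx src G ω t)) μ := by
    refine DependsBefore.integrable (r := t) _ fun ω ω' h => ?_
    rw [show activation tx src G ω t = activation tx src G ω' t from
      dependsBefore_activation hτ hG t ω ω' h]
  -- Markov's inequality: the potential is nonnegative, and at least `1` while a node is missing.
  have h1 : μ.real {ω | ∀ v, activation tx src G ω t v ≠ none}ᶜ ≤
      ∫ ω, potential k (activation tx src G ω t) ∂μ := by
    have := integral_indicator_const (μ := μ) (1 : ℝ) hm.compl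
    rw [smul_eq_mul, mul_one] at this
    rw [← this]
    refine integral_mono ((integrable_const (1 : ℝ)).indicator hm.compl) hint fun ω => ?_
    set y := activation tx src G ω t with hy
    have hcard : (informed y).card ≤ n := by simpa using Finset.card_le_univ (informed y)
    have hcard' : ((informed y).card : ℝ) ≤ n := by exact_mod_cast hcard
    by_cases hω : ω ∈ {ω | ∀ v, activation tx src G ω t v ≠ none}ᶜ
    · rw [Set.indicator_of_mem hω]
      have hω' : ¬ ∀ v, y v ≠ none := hω
      push Not at hω'
      obtain ⟨v, hv⟩ := hω'
      have h2 : (informed y).card < n := by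
        have := Finset.card_lt_univ_of_notMem (s := informed y) (x := v) (by simp [mem_informed, hv])
        simpa using this
      have h3 : ((informed y).card : ℝ) + 1 ≤ n := by exact_mod_cast h2
      have h4 : (0 : ℝ) ≤ n * ((k - (informed y).card : ℕ) : ℝ) := by positivity
      rw [potential]
      linarith
    · rw [Set.indicator_of_notMem hω, potential]
      have h4 : (0 : ℝ) ≤ n * ((k - (informed y).card : ℕ) : ℝ) := by positivity
      linarith
  rw [probReal_compl_eq_one_sub hm] at h1
  linarith

end Trajectory

/-! ### The distributed algorithm and its activation times. -/

open Classical in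
/-- The algorithm in which a node with activation time `a` transmits in round `t` if its random
choice, which is uniform on `N` values, lies in `tx t a`. Packets carry the number of the round, so
that all active nodes know the time. -/
noncomputable def clockedBroadcast (n N : ℕ) [NeZero N] (tx : ℕ → ℕ → Set (Fin N)) :
    BroadcastAlgorithm n where
  Coin := Fin N
  coinLaw := PMF.uniformOfFintype (Fin N)
  -- The activation time and the current time; for a node woken in round `t` both are `t + 1`.
  State := ℕ × ℕ
  Msg := ℕ
  init _ := (0, 0)
  wake _ m := (m + 1, m + 1)
  send _ q c := if c ∈ tx q.2 q.1 then some q.2 else none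
  next _ q _ _ := (q.1, q.2 + 1)

theorem BroadcastAlgorithm.step_of_none {n : ℕ} {A : BroadcastAlgorithm n}
    {G : SimpleGraph (Fin n)} {c : Fin n → A.Coin} {x : A.Config} {v : Fin n} (h : x v = none) :
    A.step G c x v = (received G (A.sent x c) v).map (A.wake v) := by
  simp only [BroadcastAlgorithm.step, h]

theorem BroadcastAlgorithm.step_of_some {n : ℕ} {A : BroadcastAlgorithm n}
    {G : SimpleGraph (Fin n)} {c : Fin n → A.Coin} {x : A.Config} {v : Fin n} {q : A.State}
    (h : x v = some q) :
    A.step G c x v = some (A.next v q (c v) (received G (A.sent x c) v)) := by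
  simp only [BroadcastAlgorithm.step, h]

section Clocked

variable {n N : ℕ} [NeZero N] {tx : ℕ → ℕ → Set (Fin N)}

instance : Finite (clockedBroadcast n N tx).Coin := inferInstanceAs (Finite (Fin N))

instance : DiscreteMeasurableSpace (clockedBroadcast n N tx).Coin := ⟨fun _ => trivial⟩

/-- The configuration at time `t` with given activation times. -/
def stamp (tx : ℕ → ℕ → Set (Fin N)) (t : ℕ) (x : Fin n → Option ℕ) :
    (clockedBroadcast n N tx).Config :=
  fun v => (x v).map fun a => ((a, t) : ℕ × ℕ)

open Classical in
theorem sent_clockedBroadcast (t : ℕ) (x : Fin n → Option ℕ) (c : Fin n → Fin N) (u : Fin n) :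
    (clockedBroadcast n N tx).sent (stamp tx t x) c u =
      if Transmits tx t x c u then some t else none := by
  have h1 : (clockedBroadcast n N tx).sent (stamp tx t x) c u =
      (x u).bind fun a => if c u ∈ tx t a then some t else none := by
    simp only [BroadcastAlgorithm.sent, stamp]
    cases x u <;> rfl
  rw [h1]
  rcases hx : x u with _ | a
  · rw [if_neg fun ⟨a, ha, _⟩ => by simp [hx] at ha]
    rfl
  · by_cases hc : c u ∈ tx t a
    · rw [if_pos ⟨a, hx, hc⟩]
      exact if_pos hc
    · rw [if_neg fun ⟨a', ha', hc'⟩ => hc (by rw [hx] at ha'; rwa [Option.some.inj ha'])]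
      exact if_neg hc

theorem step_clockedBroadcast (t : ℕ) (x : Fin n → Option ℕ) (c : Fin n → Fin N)
    (G : SimpleGraph (Fin n)) :
    (clockedBroadcast n N tx).step G c (stamp tx t x) =
      stamp tx (t + 1) (advance tx t G c x) := by
  classical
  have hs : ∀ u, (clockedBroadcast n N tx).sent (stamp tx t x) c u ≠ none ↔
      Transmits tx t x c u := by
    intro u
    rw [sent_clockedBroadcast]
    by_cases h : Transmits tx t x c u
    · rw [if_pos h]
      exact iff_of_true (Option.some_ne_none _) h
    · rw [if_neg h]
      exact iff_of_false (not_not_intro rfl) h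
  funext v
  rcases hx : x v with _ | a
  · have hv : (clockedBroadcast n N tx).sent (stamp tx t x) c v = none :=
      not_not.mp ((hs v).not.mpr fun ⟨a, ha, _⟩ => by simp [hx] at ha)
    have hst : stamp tx t x v = none := by rw [stamp, hx]; rfl
    have hr : (clockedBroadcast n N tx).step G c (stamp tx t x) v =
        (received G ((clockedBroadcast n N tx).sent (stamp tx t x) c) v).map
          fun m : ℕ => ((m + 1, m + 1) : ℕ × ℕ) :=
      BroadcastAlgorithm.step_of_none hst
    rw [hr]
    simp only [stamp, advance, hx]
    by_cases h : ∃! u, G.Adj v u ∧ Transmits tx t x c u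
    · have h' : ∃! u, G.Adj v u ∧
          (clockedBroadcast n N tx).sent (stamp tx t x) c u ≠ none := by simpa only [hs] using h
      rw [if_pos h, received, dif_pos ⟨hv, h'⟩, sent_clockedBroadcast,
        if_pos ((hs _).mp h'.choose_spec.1.2)]
      rfl
    · have h' : ¬ ∃! u, G.Adj v u ∧
          (clockedBroadcast n N tx).sent (stamp tx t x) c u ≠ none := by simpa only [hs] using h
      rw [if_neg h, received, dif_neg fun h'' => h' h''.2]
      rfl
  · have hst : stamp tx t x v = some ((a, t) : ℕ × ℕ) := by rw [stamp, hx]; rfl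
    refine (BroadcastAlgorithm.step_of_some hst).trans ?_
    rw [stamp, advance_of_some hx]
    rfl

theorem config_clockedBroadcast (s : Fin n) (G : (clockedBroadcast n N tx).Adversary)
    (ω : (clockedBroadcast n N tx).Coins) (t : ℕ) :
    (clockedBroadcast n N tx).config s G ω t =
      stamp tx t (activation (K := (clockedBroadcast n N tx).Coin) tx s G ω t) := by
  induction t with
  | zero =>
    funext v
    simp only [BroadcastAlgorithm.config, BroadcastAlgorithm.start, activation, stamp]
    split_ifs <;> rfl
  | succ t ih =>
    rw [BroadcastAlgorithm.config, ih]
    exact step_clockedBroadcast t _ _ _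

theorem completed_clockedBroadcast {s : Fin n} {G : (clockedBroadcast n N tx).Adversary}
    {ω : (clockedBroadcast n N tx).Coins} {t : ℕ} :
    (clockedBroadcast n N tx).Completed s G ω t ↔
      ∀ v, activation (K := (clockedBroadcast n N tx).Coin) tx s G ω t v ≠ none := by
  rw [BroadcastAlgorithm.Completed, config_clockedBroadcast]
  refine forall_congr' fun v => not_congr ?_
  exact Option.map_eq_none_iff

theorem measureReal_coin_lt {j : ℕ} (hj : j ≤ N) :
    ((clockedBroadcast n N tx).coinLaw.toMeasure).real {c : Fin N | (c : ℕ) < j} = j / N := by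
  classical
  have h := @PMF.toMeasure_uniformOfFintype_apply (Fin N) _ _ {c : Fin N | (c : ℕ) < j} ⊤ trivial _
  have hcard : Fintype.card {c : Fin N | (c : ℕ) < j} = j := by
    refine (Fintype.card_subtype _).trans (Eq.trans ?_
      (Fin.card_filter_val_lt.trans (min_eq_right hj)))
    congr
  rw [hcard, Fintype.card_fin] at h
  rw [measureReal_def]
  refine (congrArg ENNReal.toReal h).trans ?_
  simp

end Clocked

/-! ### The block schedule and its transmission probabilities. -/

/-- The number of the `N` random choices on which a node with activation time `a` transmits in
round `t`. The time is divided into blocks of `L` rounds. In the first half of a block, the nodes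
activated before transmit with probability `1 / (2 n)`; in the second half, the nodes activated in
the block transmit with probabilities that decrease harmonically. -/
def threshold (n L N t a : ℕ) : ℕ :=
  if t < t / L * L + (L + 1) / 2 then
    if a ≤ t / L * L then N / (2 * n) else 0
  else
    if a ≤ t / L * L then 0 else 4 * N / (4 + (t - max a (t / L * L + (L + 1) / 2)))

section Threshold

variable {n L t a b : ℕ}

theorem threshold_le {N : ℕ} : threshold n L N t a ≤ N := by
  unfold threshold
  split_ifs
  · exact Nat.div_le_self _ _
  · exact Nat.zero_le _
  · exact Nat.zero_le _
  · refine Nat.div_le_of_le_mul ?_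
    exact Nat.mul_le_mul_right _ (Nat.le_add_right _ _)

theorem div_mul_eq_of_mem_block {i : ℕ} (h1 : i * L ≤ t) (h2 : t < i * L + L) :
    t / L * L = i * L := by
  have hL : 0 < L := by omega
  rw [(Nat.div_eq_iff hL).mpr ⟨h1, by omega⟩]

end Threshold

theorem harmonicLoad_le (h : ℕ) : harmonicLoad h ≤ 4 * (1 + Real.log h) := by
  have h1 := harmonic_le_one_add_log h
  have h2 : harmonicLoad h ≤ 4 * (harmonic h : ℝ) := by
    rw [harmonicLoad, harmonic, Rat.cast_sum, Finset.mul_sum]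
    refine Finset.sum_le_sum fun i _ => ?_
    push_cast
    rw [← div_eq_mul_inv]
    refine div_le_div_of_nonneg_left (by norm_num) (by positivity) (by linarith)
  linarith

/-- The coin sets of the block algorithm. -/
def blockTransmit (n L N t a : ℕ) : Set (Fin N) := {c | (c : ℕ) < threshold n L N t a}

section BlockAlgorithm

variable {n L N : ℕ} [NeZero N] {i s a : ℕ}

theorem measureReal_blockTransmit :
    ((clockedBroadcast n N (blockTransmit n L N)).coinLaw.toMeasure).real
      (blockTransmit n L N s a) = threshold n L N s a / N :=
  measureReal_coin_lt threshold_le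

theorem measureReal_blockTransmit_old (hn : 0 < n) (hN : N = 2 * n * (L + 4).factorial)
    (h1 : i * L ≤ s) (h2 : s < i * L + (L + 1) / 2) (ha : a ≤ i * L) :
    ((clockedBroadcast n N (blockTransmit n L N)).coinLaw.toMeasure).real
      (blockTransmit n L N s a) = 1 / (2 * n) := by
  have hb := div_mul_eq_of_mem_block h1 (show s < i * L + L by omega)
  have hf : ((L + 4).factorial : ℝ) ≠ 0 := by exact_mod_cast (Nat.factorial_pos _).ne'
  have hn' : (n : ℝ) ≠ 0 := by exact_mod_cast hn.ne'
  rw [measureReal_blockTransmit, threshold, hb, if_pos h2, if_pos ha, hN,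
    Nat.mul_div_cancel_left _ (by omega)]
  push_cast
  field_simp

theorem blockTransmit_new (h1 : i * L ≤ s) (h2 : s < i * L + (L + 1) / 2) (ha : i * L < a) :
    blockTransmit n L N s a = ∅ := by
  have hb := div_mul_eq_of_mem_block h1 (show s < i * L + L by omega)
  rw [blockTransmit, threshold, hb, if_pos h2, if_neg (by omega)]
  simp

theorem blockTransmit_old (h1 : i * L + (L + 1) / 2 ≤ s) (h2 : s < i * L + L) (ha : a ≤ i * L) :
    blockTransmit n L N s a = ∅ := by
  have hb := div_mul_eq_of_mem_block (show i * L ≤ s by omega) h2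
  rw [blockTransmit, threshold, hb, if_neg (by omega), if_pos ha]
  simp

theorem measureReal_blockTransmit_new (hN : N = 2 * n * (L + 4).factorial)
    (h1 : i * L + (L + 1) / 2 ≤ s) (h2 : s < i * L + L) (ha : i * L < a) :
    ((clockedBroadcast n N (blockTransmit n L N)).coinLaw.toMeasure).real
      (blockTransmit n L N s a) =
        4 / (4 + ((s - max a (i * L + (L + 1) / 2) : ℕ) : ℝ)) := by
  have hb := div_mul_eq_of_mem_block (show i * L ≤ s by omega) h2
  have hN0 : (N : ℝ) ≠ 0 := by exact_mod_cast NeZero.ne N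
  rw [measureReal_blockTransmit, threshold, hb, if_neg (by omega), if_neg (by omega)]
  set r := s - max a (i * L + (L + 1) / 2) with hr
  -- The factor `(L + 4)!` of `N` makes the division exact, as `4 + r ≤ L + 4`.
  have hdvd : 4 + r ∣ 4 * N := by
    refine Dvd.dvd.mul_left ?_ _
    rw [hN]
    exact Dvd.dvd.mul_left (Nat.dvd_factorial (by omega) (by omega)) _
  have h4 : ((4 + r : ℕ) : ℝ) ≠ 0 := by positivity
  rw [Nat.cast_div hdvd h4]
  push_cast at h4 ⊢
  field_simp

/-- Completion probability of the block algorithm after `M` blocks. -/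
theorem completed_blockTransmit {T τ k m M : ℕ} (hN : N = 2 * n * (L + 4).factorial) (hk : 1 ≤ k)
    (hkn : k < n) (hL1 : 1 ≤ L) (hLτ : L ≤ τ) (hLT : L ≤ T) (hLk : L * k ≤ n) (hm1 : 1 ≤ m)
    (hmL : m ≤ L) (hm : m = 1 ∨ 3 * (m * (4 * harmonicLoad (L / 2) + 3)) ≤ (L / 2 : ℕ))
    (src : Fin n) (G : (clockedBroadcast n N (blockTransmit n L N)).Adversary)
    (hG : G.IsOblivious τ)
    (hconn : ∀ ω : (clockedBroadcast n N (blockTransmit n L N)).Coins,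
      IntervalConnected T k fun r => G r ω) :
    1 - (1 - (((L + 1) / 2 : ℕ) : ℝ) * k * m / (48 * n ^ 2)) ^ M * (n + n * k) ≤
      (clockedBroadcast n N (blockTransmit n L N)).coinMeasure.real
        {ω | (clockedBroadcast n N (blockTransmit n L N)).Completed src G ω (M * L)} := by
  have hn : 0 < n := by omega
  have hn' : (0 : ℝ) < n := by exact_mod_cast hn
  have hsum : (L + 1) / 2 + L / 2 = L := by omega
  have haL : (L + 1) / 2 ≤ L := by omega
  have hak : (L + 1) / 2 * k ≤ n := (Nat.mul_le_mul_right k haL).trans hLk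
  have hmk : m * k ≤ n := (Nat.mul_le_mul_right k hmL).trans hLk
  have hδ : (((L + 1) / 2 : ℕ) : ℝ) * k * m / (48 * n ^ 2) ≤ 1 := by
    rw [div_le_one (by positivity)]
    have h1 : (((L + 1) / 2 : ℕ) : ℝ) * k ≤ n := by exact_mod_cast hak
    have h2 : (m : ℝ) ≤ n := by
      exact_mod_cast (Nat.le_mul_of_pos_right m (by omega)).trans hmk
    have h3 := mul_le_mul h1 h2 (Nat.cast_nonneg _) hn'.le
    nlinarith
  have hstep : ∀ (i : ℕ) (ω : ℕ → Fin n → (clockedBroadcast n N (blockTransmit n L N)).Coin) (S : Finset (Fin n)) (x : Fin n → Option ℕ),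
      S.Nonempty → ActivatedBy S (i * L) (i * L) x →
      expect (clockedBroadcast n N (blockTransmit n L N)).coinLaw.toMeasure (blockTransmit n L N)
          (fun t => G t ω) (potential k) L (i * L) x ≤
        (1 - (((L + 1) / 2 : ℕ) : ℝ) * k * m / (48 * n ^ 2)) * potential k x := by
    intro i ω S x hS hx
    have := expect_potential_le (K := (clockedBroadcast n N (blockTransmit n L N)).Coin)
      (clockedBroadcast n N (blockTransmit n L N)).coinLaw.toMeasure (tx := blockTransmit n L N)
      (Γ := fun t => G t ω) (H := ⨅ j : Fin T, G (i * L + j) ω) (a := (L + 1) / 2) (h := L / 2)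
      hm1 (hconn ω (i * L)) ?_
      (fun s h1 h2 a ha => measureReal_blockTransmit_old hn hN h1 h2 ha)
      (fun s h1 h2 a ha => blockTransmit_new h1 h2 ha)
      (fun s h1 h2 a ha => blockTransmit_old h1 (by omega) ha)
      (fun s h1 h2 a ha _ => measureReal_blockTransmit_new hN h1 (by omega) ha)
      hm hk hak hmk hx hS
    · rw [hsum] at this
      exact this
    · intro s h1 h2
      refine (iInf_le _ (⟨s - i * L, by omega⟩ : Fin T)).trans (le_of_eq ?_)
      congr 1
      simp only
      omega
  have h1 := integral_potential_le (K := (clockedBroadcast n N (blockTransmit n L N)).Coin) (src := src)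
    (clockedBroadcast n N (blockTransmit n L N)).coinLaw.toMeasure hδ (hL1.trans hLτ) hLτ hG
    hstep M
  have h2 := one_sub_integral_potential_le
    (K := (clockedBroadcast n N (blockTransmit n L N)).Coin)
    (tx := blockTransmit n L N) (src := src) (k := k)
    (clockedBroadcast n N (blockTransmit n L N)).coinLaw.toMeasure (hL1.trans hLτ) hG (M * L)
  have h3 : {ω : (clockedBroadcast n N (blockTransmit n L N)).Coins | (clockedBroadcast n N (blockTransmit n L N)).Completed src G ω (M * L)} =
      {ω | ∀ v, activation (K := (clockedBroadcast n N (blockTransmit n L N)).Coin)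
        (blockTransmit n L N) src G ω (M * L) v ≠ none} := by
    ext ω
    exact completed_clockedBroadcast
  rw [h3]
  refine le_trans ?_ h2
  linarith

end BlockAlgorithm

/-! ### Choice of parameters and running time. -/

/-- The number of nodes that can be reached in the second half of a block. -/
theorem exists_spread_bound {n L : ℕ} (hn : 2 ≤ n) (hL1 : 1 ≤ L) (hLn : L ≤ n) :
    ∃ m : ℕ, 1 ≤ m ∧ m ≤ L ∧
      (m = 1 ∨ 3 * (m * (4 * harmonicLoad (L / 2) + 3)) ≤ (L / 2 : ℕ)) ∧
      (L : ℝ) ≤ 5 * (m * (162 * Real.log n)) := by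
  have hlog : 1 / 2 ≤ Real.log n := by
    have h1 : Real.log 2 ≤ Real.log n :=
      Real.log_le_log (by norm_num) (by exact_mod_cast hn)
    linarith [Real.log_two_gt_d9]
  set Q : ℝ := 162 * Real.log n with hQ
  have hQ1 : 1 ≤ Q := by linarith
  set h := L / 2 with hh
  -- The left side is at most `57 + 48 log n`, and `57 ≤ 114 log n`.
  have hload : 3 * (4 * harmonicLoad h + 3) ≤ Q := by
    have h1 := harmonicLoad_le h
    have h2 : Real.log h ≤ Real.log n := by
      rcases Nat.eq_zero_or_pos h with h0 | hpos
      · rw [h0]; simp; linarith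
      · exact Real.log_le_log (by exact_mod_cast hpos) (by exact_mod_cast (by omega))
    linarith
  have hLh : (L : ℝ) ≤ 2 * h + 1 := by exact_mod_cast (by omega : L ≤ 2 * h + 1)
  have hfl := Nat.lt_floor_add_one ((h : ℝ) / Q)
  have hfl' := Nat.floor_le (by positivity : 0 ≤ (h : ℝ) / Q)
  rw [div_lt_iff₀ (by linarith)] at hfl
  rw [le_div_iff₀ (by linarith)] at hfl'
  set f := ⌊(h : ℝ) / Q⌋₊ with hf
  -- If `f = 0`, then `h < Q` and `L ≤ 3 Q`; otherwise `h < 2 f Q` and `L ≤ 5 f Q`.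
  rcases Nat.eq_zero_or_pos f with h0 | hpos
  · refine ⟨1, le_rfl, hL1, Or.inl rfl, ?_⟩
    rw [h0] at hfl
    push_cast at *
    linarith
  · have hf1 : (1 : ℝ) ≤ f := by exact_mod_cast hpos
    refine ⟨f, hpos, ?_, Or.inr ?_, ?_⟩
    · have h1 : (f : ℝ) ≤ h := by nlinarith
      have h2 : f ≤ h := by exact_mod_cast h1
      omega
    · have := mul_le_mul_of_nonneg_left hload (Nat.cast_nonneg (α := ℝ) f)
      linarith
    · have := mul_le_mul_of_nonneg_right hf1 (by linarith : 0 ≤ Q)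
      linarith

/-- The initial potential is at most `n²`, which explains the `2` in `2 + c`. -/
theorem pow_mul_le_rpow_neg {n k M : ℕ} {c δ : ℝ} (hkn : k < n) (hδ0 : 0 < δ) (hδ1 : δ ≤ 1)
    (hM : (2 + c) * Real.log n / δ ≤ M) : (1 - δ) ^ M * (n + n * k : ℝ) ≤ 1 / (n : ℝ) ^ c := by
  have hn' : (0 : ℝ) < n := by exact_mod_cast (by omega : 0 < n)
  have h1 : (1 - δ) ^ M ≤ (n : ℝ) ^ (-(2 + c)) := by
    calc (1 - δ) ^ M ≤ Real.exp (-δ) ^ M :=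
          pow_le_pow_left₀ (by linarith) (Real.one_sub_le_exp_neg δ) M
      _ = Real.exp (-(M * δ)) := by rw [← Real.exp_nat_mul]; ring_nf
      _ ≤ Real.exp (-((2 + c) * Real.log n)) := by
          rw [div_le_iff₀ hδ0] at hM
          exact Real.exp_le_exp.mpr (by linarith)
      _ = (n : ℝ) ^ (-(2 + c)) := by rw [Real.rpow_def_of_pos hn']; ring_nf
  have h2 : (n + n * k : ℝ) ≤ (n : ℝ) ^ (2 : ℝ) := by
    have : (k : ℝ) + 1 ≤ n := by exact_mod_cast hkn
    rw [Real.rpow_two]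
    nlinarith
  calc (1 - δ) ^ M * (n + n * k : ℝ) ≤ (n : ℝ) ^ (-(2 + c)) * (n : ℝ) ^ (2 : ℝ) :=
        mul_le_mul h1 h2 (by positivity) (by positivity)
    _ = 1 / (n : ℝ) ^ c := by
        rw [← Real.rpow_add hn', one_div, ← Real.rpow_neg hn'.le]
        ring_nf

theorem theorem1 (c : ℝ) (hc : 0 < c) :
    ∃ C : ℝ, 0 < C ∧
      ∀ n T τ k : ℕ, 1 ≤ n → 1 ≤ T → 1 ≤ τ → 1 ≤ k →
        ∃ A : BroadcastAlgorithm n,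
          ∀ (s : Fin n) (G : A.Adversary),
            G.IsOblivious τ →
            (∀ ω : A.Coins, IntervalConnected T k (fun r => G r ω)) →
            1 - 1 / (n : ℝ) ^ c ≤
              A.coinMeasure.real
                {ω : A.Coins | ∃ t : ℕ,
                  (t : ℝ) ≤ C * ((1 + (n : ℝ) / ((k : ℝ) * (min τ T : ℕ))) *
                    (n : ℝ) * Real.log n ^ 3) ∧
                  A.Completed s G ω t} := by
  refine ⟨(2 + c) * 311040 * 2 + 8, by positivity, fun n T τ k hn hT hτ hk => ?_⟩
  -- The cap `n / k` gives `L * k ≤ n`, which keeps the success probabilities in the linear regime.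
  set L := min (min τ T) (n / k) with hL
  obtain ⟨N, hN⟩ : ∃ N, N = 2 * n * (L + 4).factorial := ⟨_, rfl⟩
  have : NeZero N := ⟨by rw [hN]; positivity⟩
  refine ⟨clockedBroadcast n N (blockTransmit n L N), fun s G hG hconn => ?_⟩
  -- For `k ≥ n` no admissible network exists.
  have hkn : k < n := by
    have h := (hconn (fun _ _ => (⟨0, NeZero.pos N⟩ : Fin N)) 0).1
    rwa [Fintype.card_fin] at h
  have hnk1 : 1 ≤ n / k := Nat.div_pos hkn.le hk
  have hL1 : 1 ≤ L := le_min (le_min hτ hT) hnk1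
  have hLk : L * k ≤ n := (Nat.mul_le_mul_right k (min_le_right _ _)).trans (Nat.div_mul_le_self n k)
  have hLn : L ≤ n := (Nat.le_mul_of_pos_right L hk).trans hLk
  obtain ⟨m, hm1, hmL, hm, hLm⟩ := exists_spread_bound (by omega) hL1 hLn
  set a : ℝ := (((L + 1) / 2 : ℕ) : ℝ) with ha
  set δ : ℝ := a * k * m / (48 * n ^ 2) with hδ
  set l := Real.log n with hl
  set M := ⌈(2 + c) * l / δ⌉₊ with hM
  have hn' : (0 : ℝ) < n := by exact_mod_cast hn
  have hk' : (0 : ℝ) < k := by exact_mod_cast hk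
  have hm' : (0 : ℝ) < m := by exact_mod_cast hm1
  have hL' : (0 : ℝ) < L := by exact_mod_cast hL1
  have haL : (L : ℝ) ≤ 2 * a := by
    rw [ha]; exact_mod_cast (by omega : L ≤ 2 * ((L + 1) / 2))
  have ha0 : 0 < a := by linarith
  have hδ0 : 0 < δ := by positivity
  have hδ1 : δ ≤ 1 := by
    rw [hδ, div_le_one (by positivity)]
    have h1 : a * k ≤ n := by
      rw [ha]
      exact_mod_cast (Nat.mul_le_mul_right k (by omega : (L + 1) / 2 ≤ L)).trans hLk
    have h2 : (m : ℝ) ≤ n := by exact_mod_cast hmL.trans hLn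
    have h3 := mul_le_mul h1 h2 hm'.le hn'.le
    nlinarith
  have hl2 : 1 / 2 ≤ l := by
    have h1 : Real.log 2 ≤ Real.log n :=
      Real.log_le_log (by norm_num) (by exact_mod_cast (by omega : 2 ≤ n))
    linarith [Real.log_two_gt_d9]
  have hprob := completed_blockTransmit (M := M) hN hk hkn hL1
    ((min_le_left _ _).trans (min_le_left _ _)) ((min_le_left _ _).trans (min_le_right _ _)) hLk hm1
    hmL hm s G hG hconn
  have hsmall := pow_mul_le_rpow_neg (c := c) hkn hδ0 hδ1 (Nat.le_ceil _)
  set ρ : ℝ := (n : ℝ) / ((k : ℝ) * (min τ T : ℕ)) with hρ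
  have hρ0 : 0 ≤ ρ := by positivity
  -- If the cap is active, rounding `n / k` down at most halves it, hence the `2`.
  have hblock : (n : ℝ) / (k * L) ≤ ρ + 2 := by
    rcases le_total (min τ T) (n / k) with h | h
    · rw [hρ, hL, min_eq_left h]
      linarith
    · have hLe : L = n / k := by rw [hL, min_eq_right h]
      have h1 : n ≤ 2 * (k * L) := by
        have h2 := Nat.lt_div_mul_add (a := n) (show 0 < k from hk)
        rw [← hLe] at h2
        nlinarith
      have h3 : (n : ℝ) ≤ 2 * (k * L) := by exact_mod_cast h1
      have h4 : (n : ℝ) / (k * L) ≤ 2 := by rw [div_le_iff₀ (by positivity)]; exact h3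
      linarith
  -- From `a ≥ L / 2` and `m ≥ L / (810 l)`; the constant is `48 * 2 * 810`.
  have hLδ : (L : ℝ) / δ ≤ 77760 * l * (n * (ρ + 2)) := by
    have h1 : (L : ℝ) * L ≤ 1620 * l * (a * m) := by
      have := mul_le_mul haL hLm hL'.le (by positivity)
      linarith
    have h2 : (L : ℝ) / δ ≤ 77760 * l * (n * (n / (k * L))) := by
      rw [hδ, div_div_eq_mul_div, div_le_iff₀ (by positivity)]
      have h3 : 77760 * l * (n * (n / (k * L))) * (a * k * m) =
          48 * n ^ 2 * (1620 * l * (a * m)) / L := by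
        field_simp
        ring
      rw [h3, le_div_iff₀ hL']
      have := mul_le_mul_of_nonneg_left h1 (by positivity : (0 : ℝ) ≤ 48 * n ^ 2)
      linarith
    refine h2.trans ?_
    gcongr
  have htime : ((M * L : ℕ) : ℝ) ≤
      ((2 + c) * 311040 * 2 + 8) * ((1 + ρ) * n * l ^ 3) := by
    have h1 : (M : ℝ) ≤ (2 + c) * l / δ + 1 :=
      (Nat.ceil_lt_add_one (by positivity)).le
    have h2 := mul_le_mul_of_nonneg_right h1 hL'.le
    have h3 : ((2 + c) * l / δ + 1) * L = (2 + c) * l * (L / δ) + L := by ring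
    have h4 := mul_le_mul_of_nonneg_left hLδ (by positivity : 0 ≤ (2 + c) * l)
    have h5 : (L : ℝ) ≤ n := by exact_mod_cast hLn
    -- Since `l ≥ 1 / 2`, the spare logarithm costs a factor `2`, and the rounding term `L ≤ n` is
    -- absorbed with a factor `8`.
    have hl3 : l ^ 2 ≤ 2 * l ^ 3 := by nlinarith [sq_nonneg l]
    have hl4 : 1 ≤ 8 * l ^ 3 := by nlinarith [sq_nonneg l]
    have h6 : (2 + c) * l * (77760 * l * (n * (ρ + 2))) ≤
        (2 + c) * 311040 * ((1 + ρ) * n * l ^ 3) := by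
      have h7 : (2 + c) * l * (77760 * l * (n * (ρ + 2))) =
          (2 + c) * 77760 * n * (ρ + 2) * l ^ 2 := by ring
      rw [h7]
      have h8 := mul_le_mul_of_nonneg_left hl3
        (by positivity : 0 ≤ (2 + c) * 77760 * n * (ρ + 2))
      have h9 : 0 ≤ (2 + c) * 155520 * n * ρ * l ^ 3 := by positivity
      linarith
    have h10 : (n : ℝ) ≤ 8 * ((1 + ρ) * n * l ^ 3) := by
      have h11 := mul_le_mul_of_nonneg_left hl4 hn'.le
      have h12 : 0 ≤ 8 * (ρ * n * l ^ 3) := by positivity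
      linarith
    have h13 : 0 ≤ (2 + c) * 311040 * ((1 + ρ) * n * l ^ 3) := by positivity
    push_cast
    linarith
  calc 1 - 1 / (n : ℝ) ^ c ≤ 1 - (1 - δ) ^ M * (n + n * k) := by linarith
    _ ≤ _ := hprob
    _ ≤ _ := by
      have : IsProbabilityMeasure
          (clockedBroadcast n N (blockTransmit n L N)).coinMeasure := by
        unfold BroadcastAlgorithm.coinMeasure
        infer_instance
      exact measureReal_mono fun ω hω => ⟨M * L, htime, hω⟩
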